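/- Theorem. Let $(\Lambda,\Gamma^{(1)},\Gamma^{(2)})$ be a two edge type degree distribution: $\Lambda=(\Lambda_{l_1,l_2})$ is a finitely supported probability distribution on pairs of natural numbers ($\Lambda_{l_1,l_2}$ is the fraction of variable nodes with $l_1$ edges of type one and $l_2$ edges of type two), and, for $j=1,2$, $\Gamma^{(j)}=(\Gamma^{(j)}_r)$ is a finitely supported probability distribution on natural numbers (the fraction of type $j$ check nodes of degree $r$). Put $\Lambda_j'=\sum_{l_1,l_2} l_j\Lambda_{l_1,l_2}$, $\Gamma'^{(j)}=\sum_r r\,\Gamma^{(j)}_r$, and $R_{\mathrm{des}}=1-\Lambda_1'/\Gamma'^{(1)}-\Lambda_2'/\Gamma'^{(2)}$. Assume for $j=1,2$ that $\Lambda_j'>0$ and that $\Gamma^{(j)}_r>0$ for some $r\ge 2$. Let $h(x)=-x\log_2 x-(1-x)\log_2(1-x)$, $q_r(v)=\frac{(1+v)^r+(1-v)^r}{2}$, and let $\mathcal E$ be the set of all $(e_1,e_2)$ of the form $e_j=\frac1{\Lambda_j'}\sum_{l_1,l_2} l_j\Lambda_{l_1,l_2}\,\sigma(l_1,l_2)$,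 $j=1,2$, with $0\le\sigma(l_1,l_2)\le 1$. Whenever the equations $$\frac{v_j}{\Gamma'^{(j)}}\sum_r r\,\Gamma^{(j)}_r\,\frac{(1+v_j)^{r-1}-(1-v_j)^{r-1}}{(1+v_j)^r+(1-v_j)^r}=e_j,\qquad \frac1{\Lambda_j'}\sum_{l_1,l_2} l_j\Lambda_{l_1,l_2}\,\frac{u_1^{l_1}u_2^{l_2}}{1+u_1^{l_1}u_2^{l_2}}=e_j\qquad(j=1,2)$$ have a solution $u_1,u_2,v_1,v_2>0$, let $$\theta(e_1,e_2)=\sum_{l_1,l_2}\Lambda_{l_1,l_2}\log_2\bigl(1+u_1^{l_1}u_2^{l_2}\bigr)-\sum_{j=1}^2\Lambda_j'e_j\log_2u_j+\sum_{j=1}^2\Bigl(\frac{\Lambda_j'}{\Gamma'^{(j)}}\sum_r\Gamma^{(j)}_r\log_2q_r(v_j)-\Lambda_j'e_j\log_2v_j\Bigr)-\sum_{j=1}^2\Lambda_j'h(e_j)-R_{\mathrm{des}}.$$ Then $\theta(e_1,e_2)$ does not depend on the choice of the positive solution; the supremum $\sup_{(e_1,e_2)\in\mathcal E}\theta(e_1,e_2)$,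 taken over the points of $\mathcal E$ at which $\theta$ is defined, is finite and is over a non-empty set; and $$\lim_{n\to\infty}\frac{\log_2\mathbb E[N]}{n}=\sup_{(e_1,e_2)\in\mathcal E}\theta(e_1,e_2)+R_{\mathrm{des}}.$$ Here $N$ is the number of codewords of the code of a uniformly random graph of the two edge type LDPC ensemble with $n$ variable nodes: for each type $j$, the type $j$ sockets of the variable nodes are matched with the sockets of the type $j$ check nodes by a bijection (multiple edges are allowed), the two bijections are independent and uniformly distributed, and a codeword is an assignment of bits to the variable nodes such that at every check node of either type the bits at its edges sum to $0$ modulo $2$. The limit is along any sequence of such ensembles whose block lengths $n$ tend to infinity and which have degree distribution $(\Lambda,\Gamma^{(1)},\Gamma^{(2)})$: only degrees with positive mass occur, and the fractions of the variable nodes and of the check nodes of each type that have a given degree are equal to, or at least converge to, the prescribed ones. -/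

import Mathlib

open scoped BigOperators

noncomputable section

namespace TwoEdgeLDPC

/-- A degree distribution from the node perspective, for two edge types (indexed by `Fin 2`).
`Λ l` is the fraction of variable nodes having `l 0` edges of type one and `l 1` edges of type two;
`Γ j r` is the fraction of the check nodes of type `j` that have degree `r`. -/
structure DegreeDist where
  Λ : (Fin 2 → ℕ) →₀ ℝ
  Γ : Fin 2 → ℕ →₀ ℝ
  Λ_nonneg : ∀ l, 0 ≤ Λ l
  Γ_nonneg : ∀ j r, 0 ≤ Γ j r
  Λ_sum : ∑ l ∈ Λ.support, Λ l = 1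
  Γ_sum : ∀ j, ∑ r ∈ (Γ j).support, Γ j r = 1

namespace DegreeDist

variable (D : DegreeDist)

/-- `Λ_j'(1,1)`: the average number of type `j` edges at a variable node. -/
def avgVar (j : Fin 2) : ℝ := ∑ l ∈ D.Λ.support, (l j : ℝ) * D.Λ l

/-- `Γ^(j)'(1)`: the average degree of a check node of type `j`. -/
def avgCheck (j : Fin 2) : ℝ := ∑ r ∈ (D.Γ j).support, (r : ℝ) * D.Γ j r

/-- The design rate `1 - (m₁ + m₂) / n`, where `m_j / n = Λ_j'(1,1) / Γ^(j)'(1)` is the number of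
check nodes of type `j` per variable node. -/
def designRate : ℝ := 1 - ∑ j, D.avgVar j / D.avgCheck j

/-- The region `𝓔` of normalized numbers of edges of either type that are attached to variable
nodes of value one. -/
def region : Set (Fin 2 → ℝ) :=
  {e | ∃ σ : (Fin 2 → ℕ) → ℝ, (∀ l, 0 ≤ σ l ∧ σ l ≤ 1) ∧
    ∀ j, e j = (∑ l ∈ D.Λ.support, (l j : ℝ) * D.Λ l * σ l) / D.avgVar j}

end DegreeDist

/-- The binary entropy function, in bits. -/
def entropy (x : ℝ) : ℝ := -x * Real.logb 2 x - (1 - x) * Real.logb 2 (1 - x)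

/-- `q_r(v) = ((1+v)^r + (1-v)^r) / 2`. -/
def q (r : ℕ) (v : ℝ) : ℝ := ((1 + v) ^ r + (1 - v) ^ r) / 2

/-- The monomial `u₁^{l₁} u₂^{l₂}`. -/
def mono (u : Fin 2 → ℝ) (l : Fin 2 → ℕ) : ℝ := u 0 ^ l 0 * u 1 ^ l 1

namespace DegreeDist

variable (D : DegreeDist)

/-- `u₁, u₂, v₁, v₂` are positive and solve the four saddle point equations for `(e₁, e₂)`. -/
structure IsSaddlePoint (e u v : Fin 2 → ℝ) : Prop where
  u_pos : ∀ j, 0 < u j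
  v_pos : ∀ j, 0 < v j
  check_eq : ∀ j, v j / D.avgCheck j * ∑ r ∈ (D.Γ j).support, (r : ℝ) * D.Γ j r *
    (((1 + v j) ^ (r - 1) - (1 - v j) ^ (r - 1)) / ((1 + v j) ^ r + (1 - v j) ^ r)) = e j
  var_eq : ∀ j, 1 / D.avgVar j * ∑ l ∈ D.Λ.support,
    D.Λ l * (l j : ℝ) * (mono u l / (1 + mono u l)) = e j

/-- The expression that defines `θ(e₁, e₂)`, for given `u₁, u₂, v₁, v₂`. -/
def thetaExpr (e u v : Fin 2 → ℝ) : ℝ :=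
  ∑ l ∈ D.Λ.support, D.Λ l * Real.logb 2 (1 + mono u l)
    - ∑ j, D.avgVar j * e j * Real.logb 2 (u j)
    + ∑ j, (D.avgVar j / D.avgCheck j * ∑ r ∈ (D.Γ j).support, D.Γ j r * Real.logb 2 (q r (v j))
        - D.avgVar j * e j * Real.logb 2 (v j))
    - ∑ j, D.avgVar j * entropy (e j)
    - D.designRate

/-- `θ(e₁, e₂)` is defined and equal to `t`. -/
def IsTheta (e : Fin 2 → ℝ) (t : ℝ) : Prop :=
  ∃ u v : Fin 2 → ℝ, D.IsSaddlePoint e u v ∧ t = D.thetaExpr e u v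

end DegreeDist

/-- The degree data of a two edge type ensemble of finite block length: the number of variable
nodes with each pair of degrees, and the number of check nodes of each type with each degree. Both
sides have the same number of edges of type `j`. -/
structure Ensemble where
  varCount : (Fin 2 → ℕ) →₀ ℕ
  checkCount : Fin 2 → ℕ →₀ ℕ
  edges_match : ∀ j, ∑ l ∈ varCount.support, l j * varCount l =
    ∑ r ∈ (checkCount j).support, r * checkCount j r

namespace Ensemble

variable (E : Ensemble)

/-- The number `n` of variable nodes. -/
def blockLength : ℕ := ∑ l ∈ E.varCount.support, E.varCount l

/-- The number `m_j` of check nodes of type `j`. -/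
def numChecks (j : Fin 2) : ℕ := ∑ r ∈ (E.checkCount j).support, E.checkCount j r

/-- Variable nodes: `⟨l, i⟩` is the `i`-th one with the degrees `l`. -/
abbrev VarNode : Type := Σ l : E.varCount.support, Fin (E.varCount l.1)

/-- Check nodes of type `j`: `⟨r, i⟩` is the `i`-th one with degree `r`. -/
abbrev CheckNode (j : Fin 2) : Type := Σ r : (E.checkCount j).support, Fin (E.checkCount j r.1)

/-- Sockets for type `j` edges on the variable node side. -/
abbrev VarSocket (j : Fin 2) : Type := Σ x : E.VarNode, Fin (x.1.1 j)

/-- Sockets for type `j` edges on the check node side. -/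
abbrev CheckSocket (j : Fin 2) : Type := Σ c : E.CheckNode j, Fin c.1.1

/-- A graph of the ensemble: for either edge type, a bijection between the variable side sockets
and the check side sockets (so multiple edges between two nodes are allowed). -/
abbrev Graph : Type := ∀ j : Fin 2, E.VarSocket j ≃ E.CheckSocket j

/-- The codewords of the code of a graph: at every check node, of either type, the values of
the adjacent variable nodes, counted with multiplicity, sum to zero modulo two. -/
def IsCodeword {E : Ensemble} (G : E.Graph) (w : E.VarNode → ZMod 2) : Prop :=
  ∀ (j : Fin 2) (c : E.CheckNode j), ∑ s : Fin c.1.1, w ((G j).symm ⟨c, s⟩).1 = 0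

open Classical in
/-- `N`: the number of codewords of the code of a graph. -/
def numCodewords {E : Ensemble} (G : E.Graph) : ℕ :=
  (Finset.univ.filter fun w : E.VarNode → ZMod 2 => IsCodeword G w).card

/-- `𝔼[N]` for a graph that is uniformly distributed over the ensemble. -/
def expectedCodewords : ℝ :=
  (∑ G : E.Graph, (numCodewords G : ℝ)) / (Fintype.card E.Graph : ℝ)

end Ensemble

/-- The ensembles `E 0, E 1, …` have the degree distribution `D` as their block length goes to
infinity: only degrees that have positive mass in `D` occur, and the fractions of the nodes of each
degree tend to those prescribed by `D`. This includes all sequences whose fractions are equal to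
those of `D` for every `k`. -/
structure HasDegreeDist (E : ℕ → Ensemble) (D : DegreeDist) : Prop where
  blockLength_tendsto : Filter.Tendsto (fun k => (E k).blockLength) Filter.atTop Filter.atTop
  varCount_eq_zero : ∀ k l, D.Λ l = 0 → (E k).varCount l = 0
  checkCount_eq_zero : ∀ k j r, D.Γ j r = 0 → (E k).checkCount j r = 0
  var_tendsto : ∀ l, Filter.Tendsto
    (fun k => ((E k).varCount l : ℝ) / ((E k).blockLength : ℝ)) Filter.atTop (nhds (D.Λ l))
  check_tendsto : ∀ j r, Filter.Tendsto
    (fun k => ((E k).checkCount j r : ℝ) / ((E k).numChecks j : ℝ)) Filter.atTop (nhds (D.Γ j r))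

end TwoEdgeLDPC

end

/-! A uniform matching of the type `j` sockets carries the edge values of a word to a uniformly
distributed word of the same weight on the check sockets. Hence E[N] is exactly the sum, over all
words, of the product over `j` of coeff(P_j, w_j) / binom(n_j, w_j), where n_j is the number of
edges, w_j the number of edges at ones, and P_j the weight enumerator of the words that satisfy the
checks of type `j` (`expectedCodewords_eq_sum`). The summand depends only on the type of the word,
that is, on the number of ones among the variable nodes of each degree pair. There are polynomially
many types, so the growth rate is the largest exponent of a single `typeTerm`.

The exponents are compared with θ by Lagrange duality. For a given e, `varPart` as a function of u
bounds the entropy of every choice of fractions σ that realizes e, and `checkPart` as a function of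
v does the same for the distributions of ones at the checks. Both bounds are Gibbs' inequality, with
equality at exponentially tilted distributions, and the saddle point equations say that these tilts
meet the constraints. So a positive solution minimizes the expression for θ
(`IsSaddlePoint.thetaExpr_le`), which makes its value independent of the solution. Solutions exist
in the interior because the functions to be minimized, in the variables log u and log v, are
coercive (`exists_isSaddlePoint`).

Lower bound: the tilts at a saddle point are rounded to integral types with even edge weights
(`exists_approx_type`), and one term of the expansion of P_j already has the required exponent.
Upper bound: coeff(P_j, w) v^w ≤ P_j(v) for every v > 0, and the dominant types have a limit by
compactness. The limit may be a boundary point without a saddle point, so it is first mixed with an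
interior point (`le_of_forall_le`). -/

noncomputable section

/-! ### Binary words, their weights, and the weight enumerator of the check side -/

namespace TwoEdgeLDPC

open Finset Polynomial

/-- The number of ones of a binary word. -/
def weight {α : Type*} [Fintype α] (x : α → ZMod 2) : ℕ := #{a | x a = 1}

/-- The weight enumerator of the even words of length `r`. -/
def evenPoly (r : ℕ) : ℕ[X] :=
  ∑ a ∈ range (r / 2 + 1), monomial (2 * a) (r.choose (2 * a))

lemma weight_sigma {α : Type*} {β : α → Type*} [Fintype α] [∀ a, Fintype (β a)]
    (x : (Σ a, β a) → ZMod 2) : weight x = ∑ a, weight fun b => x ⟨a, b⟩ := by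
  classical
  simp only [weight, card_filter]
  exact Fintype.sum_sigma _

lemma zmod_two_eq (z : ZMod 2) : z = if z = 1 then 1 else 0 := by
  revert z; decide

lemma sum_eq_weight {α : Type*} [Fintype α] (x : α → ZMod 2) : ∑ a, x a = (weight x : ZMod 2) := by
  rw [weight, card_filter, Nat.cast_sum]
  refine sum_congr rfl fun a _ => ?_
  rw [zmod_two_eq (x a)]
  split_ifs <;> simp_all

lemma sum_eq_zero_iff_even_weight {α : Type*} [Fintype α] (x : α → ZMod 2) :
    ∑ a, x a = 0 ↔ Even (weight x) := by
  rw [sum_eq_weight, ZMod.natCast_eq_zero_iff_even]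

/-- Binary words correspond to their supports. -/
def wordEquiv (α : Type*) [Fintype α] [DecidableEq α] : (α → ZMod 2) ≃ Finset α where
  toFun x := {a | x a = 1}
  invFun s a := if a ∈ s then 1 else 0
  left_inv x := by
    ext a
    simp only [mem_filter, mem_univ, true_and]
    exact (zmod_two_eq (x a)).symm
  right_inv s := by
    ext a
    simp

lemma sum_words_weight {α M : Type*} [Fintype α] [DecidableEq α] [AddCommMonoid M] (f : ℕ → M) :
    ∑ x : α → ZMod 2, f (weight x) =
      ∑ m ∈ range (Fintype.card α + 1), (Fintype.card α).choose m • f m := by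
  classical
  rw [← card_univ, ← sum_powerset_apply_card f, powerset_univ]
  exact Fintype.sum_equiv (wordEquiv α) _ _ fun x => rfl

lemma sum_range_even {M : Type*} [AddCommMonoid M] (f : ℕ → M) (r : ℕ) :
    ∑ m ∈ range (r + 1) with Even m, f m = ∑ a ∈ range (r / 2 + 1), f (2 * a) := by
  symm
  refine sum_nbij (fun a => 2 * a) ?_ ?_ ?_ fun _ _ => rfl
  · intro a ha
    simp only [mem_range, mem_filter] at ha ⊢
    exact ⟨by omega, even_two_mul a⟩
  · intro a _ b _ h
    simpa using h
  · intro m hm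
    simp only [coe_filter, mem_range, Set.mem_ofPred_eq] at hm
    obtain ⟨a, ha⟩ := hm.2
    exact ⟨a, by simp only [coe_range, Set.mem_Iio]; omega, by simp only; omega⟩

lemma sum_even_words (r : ℕ) :
    ∑ y : Fin r → ZMod 2 with ∑ s, y s = 0, (X : ℕ[X]) ^ weight y = evenPoly r := by
  simp only [sum_eq_zero_iff_even_weight]
  rw [sum_filter, sum_words_weight (fun m => if Even m then (X : ℕ[X]) ^ m else 0), Fintype.card_fin]
  simp only [smul_ite, smul_zero]
  rw [← sum_filter, sum_range_even (fun m => r.choose m • (X : ℕ[X]) ^ m)]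
  refine sum_congr rfl fun a _ => ?_
  rw [X_pow_eq_monomial, smul_monomial, smul_eq_mul, mul_one]

namespace Ensemble

variable (E : Ensemble)

/-- The weight enumerator of the words on the check side sockets of type `j` that satisfy all checks
of type `j`. -/
def checkPoly (j : Fin 2) : ℕ[X] :=
  ∏ r ∈ (E.checkCount j).support, evenPoly r ^ E.checkCount j r

/-- The words on the check side sockets of type `j` that satisfy all checks. -/
abbrev IsEvenWord {E : Ensemble} {j : Fin 2} (y : E.CheckSocket j → ZMod 2) : Prop :=
  ∀ c, ∑ s, y ⟨c, s⟩ = 0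

lemma sum_evenWord (j : Fin 2) :
    ∑ y : E.CheckSocket j → ZMod 2 with IsEvenWord y, (X : ℕ[X]) ^ weight y = E.checkPoly j := by
  classical
  have h1 : ∏ c : E.CheckNode j, evenPoly c.1.1 = E.checkPoly j := by
    rw [Fintype.prod_sigma, checkPoly, ← prod_coe_sort _ fun r => evenPoly r ^ E.checkCount j r]
    simp
  rw [← h1]
  simp only [← sum_even_words]
  rw [prod_univ_sum]
  refine sum_equiv (Equiv.piCurry fun _ _ => ZMod 2) ?_ ?_
  · intro y
    simp [IsEvenWord, Fintype.mem_piFinset, Sigma.curry]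
  · intro y _
    rw [weight_sigma, prod_pow_eq_pow_sum]
    rfl

lemma card_evenWord (j : Fin 2) (e : ℕ) :
    #{y : E.CheckSocket j → ZMod 2 | IsEvenWord y ∧ weight y = e} = (E.checkPoly j).coeff e := by
  rw [← sum_evenWord, finsetSum_coeff]
  simp only [coeff_X_pow]
  rw [← filter_filter, card_filter]
  simp only [eq_comm]

end Ensemble

/-! ### Counting matchings, and the exact formula for the expected number of codewords -/

lemma card_fiber_zero {α : Type*} [Fintype α] (x : α → ZMod 2) :
    #{a | x a = 0} = Fintype.card α - weight x := by
  classical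
  have h := card_filter_add_card_filter_not (s := (univ : Finset α)) (fun a => x a = 1)
  have h2 : ∀ z : ZMod 2, ¬ z = 1 ↔ z = 0 := by decide
  simp only [h2, card_univ] at h
  rw [weight]; omega

lemma weight_le_card {α : Type*} [Fintype α] (x : α → ZMod 2) : weight x ≤ Fintype.card α :=
  card_le_univ _

lemma weight_comp_equiv {α β : Type*} [Fintype α] [Fintype β] (x : α → ZMod 2) (σ : β ≃ α) :
    weight (x ∘ σ) = weight x := by
  classical
  simp only [weight, card_filter]
  exact Equiv.sum_comp σ fun a => if x a = 1 then 1 else 0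

/-- Composition with one fixed bijection `τ` that carries `x` to `y` identifies these bijections
with the permutations that preserve `x`. Those permute the ones and the zeros separately. -/
lemma card_equiv_comp_eq {α β : Type*} [Fintype α] [Fintype β] [DecidableEq α] [DecidableEq β]
    (x : α → ZMod 2) (y : β → ZMod 2) (hcard : Fintype.card α = Fintype.card β)
    (hw : weight x = weight y) :
    #{σ : α ≃ β | x ∘ σ.symm = y} =
      (weight x).factorial * (Fintype.card α - weight x).factorial := by
  have hfib : ∀ c : ZMod 2, Fintype.card {a // x a = c} = Fintype.card {b // y b = c} := by
    intro c
    rw [Fintype.card_subtype, Fintype.card_subtype]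
    have : c = 0 ∨ c = 1 := by revert c; decide
    rcases this with rfl | rfl
    · rw [card_fiber_zero, card_fiber_zero, hw, hcard]
    · exact hw
  let τ : α ≃ β := Equiv.ofFiberEquiv fun c => Fintype.equivOfCardEq (hfib c)
  have hτ : ∀ a, y (τ a) = x a := Equiv.ofFiberEquiv_map _
  have h1 : #{σ : α ≃ β | x ∘ σ.symm = y} = Fintype.card {g : Equiv.Perm α // x ∘ g = x} := by
    rw [Fintype.card_subtype]
    refine card_bij' (fun σ _ => τ.trans σ.symm) (fun g _ => g.symm.trans τ) ?_ ?_ ?_ ?_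
    · intro σ hσ
      simp only [mem_filter, mem_univ, true_and] at hσ ⊢
      ext a
      have := congrFun hσ (τ a)
      simp only [Function.comp_apply] at this
      simp [this, hτ]
    · intro g hg
      simp only [mem_filter, mem_univ, true_and] at hg ⊢
      ext b
      have := congrFun hg (τ.symm b)
      simp only [Function.comp_apply] at this
      simp [this, ← hτ]
    · intro σ _
      ext a
      simp
    · intro g _
      ext a
      simp
  rw [h1, DomMulAct.stabilizer_card]
  have h2 : (univ : Finset (ZMod 2)) = {0, 1} := rfl
  rw [h2, prod_pair (by decide), Fintype.card_subtype, Fintype.card_subtype, card_fiber_zero,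
    mul_comm]
  rfl

namespace Ensemble

variable {E : Ensemble}

lemma card_varSocket (E : Ensemble) (j : Fin 2) :
    Fintype.card (E.VarSocket j) = ∑ l ∈ E.varCount.support, l j * E.varCount l := by
  rw [Fintype.card_sigma, Fintype.sum_sigma, ← sum_coe_sort _ fun l => l j * E.varCount l]
  simp [mul_comm]

lemma card_checkSocket (E : Ensemble) (j : Fin 2) :
    Fintype.card (E.CheckSocket j) = ∑ l ∈ E.varCount.support, l j * E.varCount l := by
  rw [E.edges_match, Fintype.card_sigma, Fintype.sum_sigma,
    ← sum_coe_sort _ fun r => r * E.checkCount j r]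
  simp [mul_comm]

/-- The number of edges of type `j`. -/
def numEdges (E : Ensemble) (j : Fin 2) : ℕ := ∑ l ∈ E.varCount.support, l j * E.varCount l

/-- The number of edges of type `j` that are attached to variable nodes of value one. -/
def edgeWeight (w : E.VarNode → ZMod 2) (j : Fin 2) : ℕ :=
  weight fun s : E.VarSocket j => w s.1

/-- The matchings are grouped by the word that they induce on the check sockets. The admissible
words of the right weight are counted by the coefficient, and each arises from the same number of
matchings. -/
lemma card_matchings (w : E.VarNode → ZMod 2) (j : Fin 2) :
    #{σ : E.VarSocket j ≃ E.CheckSocket j |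
        ∀ c : E.CheckNode j, ∑ s : Fin c.1.1, w (σ.symm ⟨c, s⟩).1 = 0} =
      (E.checkPoly j).coeff (edgeWeight w j) *
        ((edgeWeight w j).factorial * (E.numEdges j - edgeWeight w j).factorial) := by
  classical
  set x : E.VarSocket j → ZMod 2 := fun s => w s.1 with hx
  rw [← card_evenWord]
  have hmaps : ∀ σ ∈ ({σ : E.VarSocket j ≃ E.CheckSocket j |
        ∀ c : E.CheckNode j, ∑ s : Fin c.1.1, w (σ.symm ⟨c, s⟩).1 = 0} : Finset _),
      x ∘ σ.symm ∈ ({y : E.CheckSocket j → ZMod 2 | IsEvenWord y ∧ weight y = edgeWeight w j} :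
        Finset _) := by
    intro σ hσ
    simp only [mem_filter, mem_univ, true_and] at hσ ⊢
    exact ⟨hσ, weight_comp_equiv x σ.symm⟩
  rw [card_eq_sum_card_fiberwise hmaps, ← smul_eq_mul, ← sum_const]
  refine sum_congr rfl fun y hy => ?_
  simp only [mem_filter, mem_univ, true_and] at hy
  rw [filter_filter]
  have : ∀ σ : E.VarSocket j ≃ E.CheckSocket j,
      ((∀ c : E.CheckNode j, ∑ s : Fin c.1.1, w (σ.symm ⟨c, s⟩).1 = 0) ∧ x ∘ σ.symm = y) ↔
        x ∘ σ.symm = y := by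
    intro σ
    refine ⟨fun h => h.2, fun h => ⟨?_, h⟩⟩
    have := hy.1
    rw [← h] at this
    exact this
  simp only [this]
  rw [card_equiv_comp_eq x y (by rw [card_varSocket, card_checkSocket]) hy.2.symm, card_varSocket]
  rfl

lemma card_graph (E : Ensemble) : Fintype.card E.Graph = ∏ j, (E.numEdges j).factorial := by
  rw [Fintype.card_pi]
  refine prod_congr rfl fun j _ => ?_
  rw [Fintype.card_equiv (Fintype.equivOfCardEq (by rw [card_varSocket, card_checkSocket])),
    card_varSocket]
  rfl

lemma edgeWeight_le (w : E.VarNode → ZMod 2) (j : Fin 2) : edgeWeight w j ≤ E.numEdges j := by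
  rw [numEdges, ← card_varSocket]
  exact weight_le_card _

/-- Graphs and words are summed in the opposite order. For a fixed word the conditions on the two
matchings are independent, and the factorials divided by the number of matchings leave an inverse
binomial coefficient. -/
lemma expectedCodewords_eq_sum (E : Ensemble) :
    E.expectedCodewords = ∑ w : E.VarNode → ZMod 2, ∏ j,
      ((E.checkPoly j).coeff (edgeWeight w j) : ℝ) / (E.numEdges j).choose (edgeWeight w j) := by
  classical
  have h1 : ∑ G : E.Graph, numCodewords G =
      ∑ w : E.VarNode → ZMod 2, ∏ j, (E.checkPoly j).coeff (edgeWeight w j) *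
        ((edgeWeight w j).factorial * (E.numEdges j - edgeWeight w j).factorial) := by
    simp only [numCodewords, card_filter]
    rw [sum_comm]
    refine sum_congr rfl fun w _ => ?_
    rw [← card_filter]
    simp only [← card_matchings]
    rw [← Fintype.card_piFinset]
    congr 1
    ext G
    simp [IsCodeword, Fintype.mem_piFinset]
  rw [expectedCodewords, ← Nat.cast_sum, h1, card_graph, Nat.cast_sum, sum_div]
  refine sum_congr rfl fun w _ => ?_
  rw [Nat.cast_prod, Nat.cast_prod, ← prod_div_distrib]
  refine prod_congr rfl fun j _ => ?_
  rw [Nat.cast_choose ℝ (edgeWeight_le w j)]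
  push_cast
  have := Nat.factorial_ne_zero (E.numEdges j)
  field_simp

/-! ### Grouping words by type -/

/-- The number of variable nodes of degree `l` that have value one. -/
def typeOf (w : E.VarNode → ZMod 2) (l : E.varCount.support) : ℕ := weight fun i => w ⟨l, i⟩

lemma edgeWeight_eq (w : E.VarNode → ZMod 2) (j : Fin 2) :
    edgeWeight w j = ∑ l : E.varCount.support, l.1 j * typeOf w l := by
  rw [edgeWeight, weight_sigma, Fintype.sum_sigma]
  refine sum_congr rfl fun l _ => ?_
  rw [typeOf, weight, card_filter, mul_sum]
  refine sum_congr rfl fun i _ => ?_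
  simp only [weight]
  by_cases h : w ⟨l, i⟩ = 1 <;> simp [h]

lemma card_typeOf (k : E.varCount.support → ℕ) :
    #{w : E.VarNode → ZMod 2 | typeOf w = k} = ∏ l, (E.varCount l.1).choose (k l) := by
  classical
  have h : ∀ l : E.varCount.support,
      #{x : Fin (E.varCount l.1) → ZMod 2 | weight x = k l} = (E.varCount l.1).choose (k l) := by
    intro l
    rw [card_filter, sum_words_weight fun m => if m = k l then 1 else 0, Fintype.card_fin]
    simp only [smul_eq_mul, mul_ite, mul_one, mul_zero, sum_ite_eq', mem_range]
    split_ifs with h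
    · rfl
    · rw [Nat.choose_eq_zero_of_lt (by omega)]
  simp only [← h]
  rw [← Fintype.card_piFinset]
  refine card_equiv (Equiv.piCurry fun (l : E.varCount.support) (_ : Fin (E.varCount l.1)) => ZMod 2) ?_
  intro w
  simp only [mem_filter, mem_univ, true_and, Fintype.mem_piFinset, funext_iff]
  rfl

/-- The contribution to the expected number of codewords of the words that have `k l` ones among
the variable nodes of degrees `l`, for every `l`. -/
def typeTerm (E : Ensemble) (k : (Fin 2 → ℕ) → ℕ) : ℝ :=
  (∏ l ∈ E.varCount.support, ((E.varCount l).choose (k l) : ℝ)) *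
    ∏ j, ((E.checkPoly j).coeff (∑ l ∈ E.varCount.support, l j * k l) : ℝ) /
      (E.numEdges j).choose (∑ l ∈ E.varCount.support, l j * k l)

lemma typeTerm_nonneg (E : Ensemble) (k : (Fin 2 → ℕ) → ℕ) : 0 ≤ E.typeTerm k :=
  mul_nonneg (prod_nonneg fun _ _ => Nat.cast_nonneg _)
    (prod_nonneg fun _ _ => div_nonneg (Nat.cast_nonneg _) (Nat.cast_nonneg _))

lemma sum_typeOf_eq (k : (Fin 2 → ℕ) → ℕ) :
    ∑ w : E.VarNode → ZMod 2 with typeOf w = fun l => k l.1, ∏ j,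
      ((E.checkPoly j).coeff (edgeWeight w j) : ℝ) / (E.numEdges j).choose (edgeWeight w j) =
    E.typeTerm k := by
  have : ∀ w ∈ ({w : E.VarNode → ZMod 2 | typeOf w = fun l => k l.1} : Finset _), ∏ j,
      ((E.checkPoly j).coeff (edgeWeight w j) : ℝ) / (E.numEdges j).choose (edgeWeight w j) =
      ∏ j, ((E.checkPoly j).coeff (∑ l ∈ E.varCount.support, l j * k l) : ℝ) /
      (E.numEdges j).choose (∑ l ∈ E.varCount.support, l j * k l) := by
    intro w hw
    simp only [mem_filter, mem_univ, true_and] at hw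
    simp only [edgeWeight_eq, hw]
    refine prod_congr rfl fun j _ => ?_
    rw [sum_coe_sort E.varCount.support fun l => l j * k l]
  rw [sum_congr rfl this, sum_const, card_typeOf, nsmul_eq_mul, typeTerm, Nat.cast_prod,
    prod_coe_sort E.varCount.support fun l => ((E.varCount l).choose (k l) : ℝ)]

lemma typeTerm_le_expectedCodewords (E : Ensemble) (k : (Fin 2 → ℕ) → ℕ) :
    E.typeTerm k ≤ E.expectedCodewords := by
  rw [← sum_typeOf_eq, expectedCodewords_eq_sum]
  exact sum_le_sum_of_subset_of_nonneg (filter_subset _ _)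
    fun w _ _ => prod_nonneg fun _ _ => div_nonneg (Nat.cast_nonneg _) (Nat.cast_nonneg _)

lemma varCount_le_blockLength (E : Ensemble) (l : Fin 2 → ℕ) : E.varCount l ≤ E.blockLength := by
  by_cases h : l ∈ E.varCount.support
  · exact single_le_sum (f := fun l => E.varCount l) (fun _ _ => Nat.zero_le _) h
  · simp [Finsupp.notMem_support_iff.1 h]

/-- The number of types is at most polynomial in the block length, so the largest type term
determines the exponential growth. -/
lemma exists_expectedCodewords_le (E : Ensemble) : ∃ k : (Fin 2 → ℕ) → ℕ,
    (∀ l, k l ≤ E.varCount l) ∧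
      E.expectedCodewords ≤ (E.blockLength + 1 : ℝ) ^ #E.varCount.support * E.typeTerm k := by
  classical
  set K : Finset (E.varCount.support → ℕ) :=
    Fintype.piFinset fun l => range (E.varCount l.1 + 1) with hK
  let ext : (E.varCount.support → ℕ) → (Fin 2 → ℕ) → ℕ :=
    fun k l => if h : l ∈ E.varCount.support then k ⟨l, h⟩ else 0
  have hext : ∀ k : E.varCount.support → ℕ, (fun l : E.varCount.support => ext k l.1) = k := by
    intro k; ext l; exact dif_pos l.2
  have hne : K.Nonempty := ⟨0, by simp [hK]⟩
  have hmem : ∀ w ∈ (univ : Finset (E.VarNode → ZMod 2)), typeOf w ∈ K := by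
    intro w _
    simp only [hK, Fintype.mem_piFinset, mem_range, Nat.lt_succ_iff]
    intro l
    exact (weight_le_card _).trans (Fintype.card_fin _).le
  obtain ⟨k, hk, hmax⟩ := K.exists_max_image (fun k => E.typeTerm (ext k)) hne
  refine ⟨ext k, ?_, ?_⟩
  · intro l
    simp only [ext]
    split_ifs with h
    · simp only [hK, Fintype.mem_piFinset, mem_range, Nat.lt_succ_iff] at hk
      exact hk ⟨l, h⟩
    · exact Nat.zero_le _
  · rw [expectedCodewords_eq_sum, ← sum_fiberwise_of_maps_to hmem]
    have h1 : ∀ k' ∈ K, (∑ w : E.VarNode → ZMod 2 with typeOf w = k', ∏ j,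
      ((E.checkPoly j).coeff (edgeWeight w j) : ℝ) / (E.numEdges j).choose (edgeWeight w j)) ≤
        E.typeTerm (ext k) := by
      intro k' hk'
      rw [← hext k', sum_typeOf_eq]
      exact hmax k' hk'
    refine (sum_le_card_nsmul K _ _ h1).trans ?_
    rw [nsmul_eq_mul]
    refine mul_le_mul_of_nonneg_right ?_ (E.typeTerm_nonneg _)
    rw [hK, Fintype.card_piFinset]
    push_cast
    simp only [card_range]
    calc ∏ l : E.varCount.support, ((E.varCount l.1 + 1 : ℕ) : ℝ)
        ≤ ∏ l : E.varCount.support, (E.blockLength + 1 : ℝ) := by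
          refine prod_le_prod (fun _ _ => Nat.cast_nonneg _) fun l _ => ?_
          push_cast
          have := E.varCount_le_blockLength l.1
          gcongr
      _ = _ := by simp

end Ensemble

end TwoEdgeLDPC

end

/-! ### Gibbs' inequality and the polynomials `q r` -/

noncomputable section

namespace TwoEdgeLDPC

open Finset Real

/-- Gibbs' inequality. -/
lemma sum_negMulLog_add_le {ι : Type*} (s : Finset ι) (p z : ι → ℝ) (hp : ∀ i ∈ s, 0 ≤ p i)
    (hsum : ∑ i ∈ s, p i = 1) (hz : ∀ i ∈ s, 0 < z i) :
    ∑ i ∈ s, (negMulLog (p i) + p i * log (z i)) ≤ log (∑ i ∈ s, z i) := by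
  have hne : s.Nonempty := by
    rw [nonempty_iff_ne_empty]; rintro rfl; simp at hsum
  set Z := ∑ i ∈ s, z i with hZ
  have hZpos : 0 < Z := sum_pos hz hne
  -- This is `log y ≤ y - 1` at `y = z i / (Z * p i)`. The corrections `z i / Z - p i` sum to zero.
  have h : ∀ i ∈ s, negMulLog (p i) + p i * log (z i) ≤ z i / Z - p i + p i * log Z := by
    intro i hi
    rcases (hp i hi).eq_or_lt with h0 | h0
    · rw [← h0]
      simp [div_nonneg (hz i hi).le hZpos.le]
    · have h1 := log_le_sub_one_of_pos (x := z i / Z / p i) (by have := hz i hi; positivity)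
      rw [log_div (div_pos (hz i hi) hZpos).ne' h0.ne', log_div (hz i hi).ne' hZpos.ne'] at h1
      have h2 := mul_le_mul_of_nonneg_left h1 h0.le
      have h3 : p i * (z i / Z / p i - 1) = z i / Z - p i := by field_simp
      rw [h3] at h2
      rw [negMulLog]
      linarith
  refine (sum_le_sum h).trans ?_
  rw [sum_add_distrib, sum_sub_distrib, ← sum_div, ← sum_mul, hsum, ← hZ, div_self hZpos.ne']
  simp

/-- The equality case of Gibbs' inequality: probabilities proportional to the weights. -/
lemma sum_negMulLog_add_eq {ι : Type*} (s : Finset ι) (z : ι → ℝ) (hz : ∀ i ∈ s, 0 < z i)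
    (hne : s.Nonempty) :
    ∑ i ∈ s, (negMulLog (z i / ∑ i ∈ s, z i) + z i / (∑ i ∈ s, z i) * log (z i)) =
      log (∑ i ∈ s, z i) := by
  set Z := ∑ i ∈ s, z i with hZ
  have hZpos : 0 < Z := sum_pos hz hne
  have h : ∀ i ∈ s, negMulLog (z i / Z) + z i / Z * log (z i) = z i / Z * log Z := by
    intro i hi
    rw [negMulLog, log_div (hz i hi).ne' hZpos.ne']
    ring
  rw [sum_congr rfl h, ← sum_mul, ← sum_div, ← hZ, div_self hZpos.ne', one_mul]

/-- Gibbs' inequality for the two weights `1` and `m`, which belong to the values zero and one of a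
variable node. -/
lemma binEntropy_add_mul_log_le {p m : ℝ} (hp0 : 0 ≤ p) (hp1 : p ≤ 1) (hm : 0 < m) :
    binEntropy p + p * log m ≤ log (1 + m) := by
  have h := sum_negMulLog_add_le (univ : Finset (Fin 2)) ![1 - p, p] ![1, m]
    (by intro i _; fin_cases i <;> simp [hp0, hp1]) (by simp) (by intro i _; fin_cases i <;> simp [hm])
  simp only [Fin.sum_univ_two, Matrix.cons_val_zero, Matrix.cons_val_one, log_one] at h
  rw [binEntropy_eq_negMulLog_add_negMulLog_one_sub]
  linarith

lemma binEntropy_add_mul_log_eq {m : ℝ} (hm : 0 < m) :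
    binEntropy (m / (1 + m)) + m / (1 + m) * log m = log (1 + m) := by
  have h := sum_negMulLog_add_eq (univ : Finset (Fin 2)) ![1, m]
    (by intro i _; fin_cases i <;> simp [hm]) univ_nonempty
  simp only [Fin.sum_univ_two, Matrix.cons_val_zero, Matrix.cons_val_one, log_one] at h
  rw [binEntropy_eq_negMulLog_add_negMulLog_one_sub]
  have : 1 - m / (1 + m) = 1 / (1 + m) := by field_simp; ring
  rw [this]
  linarith

lemma entropy_eq (x : ℝ) : entropy x = binEntropy x / log 2 := by
  rw [entropy, binEntropy_eq_negMulLog_add_negMulLog_one_sub, negMulLog, negMulLog, logb, logb]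
  ring

/-- The terms of `q r v`. -/
def qTerm (r : ℕ) (v : ℝ) (a : ℕ) : ℝ := (r.choose (2 * a) : ℝ) * v ^ (2 * a)

lemma qTerm_pos {r a : ℕ} {v : ℝ} (hv : 0 < v) (ha : a ∈ range (r / 2 + 1)) : 0 < qTerm r v a := by
  have : 0 < r.choose (2 * a) := Nat.choose_pos (by simp only [mem_range] at ha; omega)
  rw [qTerm]; positivity

lemma q_eq_sum (r : ℕ) (v : ℝ) : q r v = ∑ a ∈ range (r / 2 + 1), qTerm r v a := by
  simp only [qTerm]
  rw [← sum_range_even (fun m => (r.choose m : ℝ) * v ^ m), sum_filter, q, sub_eq_add_neg,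
    add_comm 1 v, add_comm 1 (-v), add_pow, add_pow, ← sum_add_distrib, sum_div]
  refine sum_congr rfl fun m _ => ?_
  rcases Nat.even_or_odd m with h | h
  · rw [if_pos h, h.neg_pow]; simp; ring
  · rw [if_neg (Nat.not_even_iff_odd.2 h), h.neg_pow]; simp

lemma eval_evenPoly (r : ℕ) (v : ℝ) : (evenPoly r).eval₂ (Nat.castRingHom ℝ) v = q r v := by
  rw [evenPoly, Polynomial.eval₂_finsetSum, q_eq_sum]
  simp [Polynomial.eval₂_monomial, qTerm]

lemma q_pos (r : ℕ) {v : ℝ} (hv : 0 < v) : 0 < q r v := by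
  rw [q_eq_sum]
  exact sum_pos (fun a ha => qTerm_pos hv ha) (by simp)

/-- The derivative of `q r`. -/
def qDeriv (r : ℕ) (v : ℝ) : ℝ := r * ((1 + v) ^ (r - 1) - (1 - v) ^ (r - 1)) / 2

lemma hasDerivAt_q (r : ℕ) (v : ℝ) : HasDerivAt (q r) (qDeriv r v) v := by
  have h1 : HasDerivAt (fun x : ℝ => 1 + x) 1 v := (hasDerivAt_id v).const_add 1
  have h2 : HasDerivAt (fun x : ℝ => 1 - x) (-1) v := (hasDerivAt_id v).const_sub 1
  have h := ((h1.pow r).add (h2.pow r)).div_const 2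
  refine h.congr_deriv ?_
  rw [qDeriv]; ring

/-- The operator v d/dv multiplies each monomial by its degree. Differentiating the closed form and
the expansion of `q r` therefore expresses the check equation as a mean number of ones. -/
lemma mul_qDeriv (r : ℕ) (v : ℝ) :
    v * qDeriv r v = ∑ a ∈ range (r / 2 + 1), ((2 * a : ℕ) : ℝ) * qTerm r v a := by
  have h : HasDerivAt (q r)
      (∑ a ∈ range (r / 2 + 1), (r.choose (2 * a) : ℝ) * (((2 * a : ℕ) : ℝ) * v ^ (2 * a - 1))) v := by
    have : q r = fun v => ∑ a ∈ range (r / 2 + 1), (r.choose (2 * a) : ℝ) * v ^ (2 * a) := by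
      ext x; rw [q_eq_sum]; rfl
    rw [this]
    exact HasDerivAt.fun_sum fun a _ => (hasDerivAt_pow (2 * a) v).const_mul _
  rw [(hasDerivAt_q r v).unique h, mul_sum]
  refine sum_congr rfl fun a _ => ?_
  rw [qTerm]
  rcases Nat.eq_zero_or_pos a with rfl | ha
  · simp
  · rw [← Nat.sub_add_cancel (show 1 ≤ 2 * a by omega), pow_succ, Nat.add_sub_cancel]
    ring

lemma mul_qDeriv_div_q (r : ℕ) (v : ℝ) :
    v * qDeriv r v / q r v =
      v * (r * (((1 + v) ^ (r - 1) - (1 - v) ^ (r - 1)) / ((1 + v) ^ r + (1 - v) ^ r))) := by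
  rw [qDeriv, q, ← mul_div_assoc, ← mul_div_assoc, ← mul_div_assoc, div_div_div_cancel_right₀ two_ne_zero]

lemma mono_pos {u : Fin 2 → ℝ} (hu : ∀ j, 0 < u j) (l : Fin 2 → ℕ) : 0 < mono u l :=
  mul_pos (pow_pos (hu 0) _) (pow_pos (hu 1) _)

lemma log_mono {u : Fin 2 → ℝ} (hu : ∀ j, 0 < u j) (l : Fin 2 → ℕ) :
    log (mono u l) = ∑ j, (l j : ℝ) * log (u j) := by
  rw [mono, log_mul (pow_pos (hu 0) _).ne' (pow_pos (hu 1) _).ne', log_pow, log_pow,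
    Fin.sum_univ_two]

/-! ### Duality: saddle points minimize the expression for θ -/

namespace DegreeDist

variable (D : DegreeDist)

/-- The fractions of the edges that are attached to variable nodes of value one, if the fraction
`σ l` of the variable nodes with degrees `l` has this value. -/
def edgeFrac (σ : (Fin 2 → ℕ) → ℝ) (j : Fin 2) : ℝ :=
  (∑ l ∈ D.Λ.support, (l j : ℝ) * D.Λ l * σ l) / D.avgVar j

/-- The part of `thetaExpr` that is due to the variable nodes, in nats. -/
def varPart (e u : Fin 2 → ℝ) : ℝ :=
  ∑ l ∈ D.Λ.support, D.Λ l * log (1 + mono u l) - ∑ j, D.avgVar j * e j * log (u j)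

/-- The part of `thetaExpr` that is due to the check nodes of type `j`, in nats. -/
def checkPart (j : Fin 2) (e v : ℝ) : ℝ :=
  D.avgVar j / D.avgCheck j * ∑ r ∈ (D.Γ j).support, D.Γ j r * log (q r v)
    - D.avgVar j * e * log v

lemma thetaExpr_add_designRate (e u v : Fin 2 → ℝ) :
    (D.thetaExpr e u v + D.designRate) * log 2 =
      D.varPart e u + ∑ j, D.checkPart j (e j) (v j) - ∑ j, D.avgVar j * binEntropy (e j) := by
  have h2 : log 2 ≠ 0 := (log_pos one_lt_two).ne'
  simp only [thetaExpr, varPart, checkPart, entropy_eq, logb, Fin.sum_univ_two, ← mul_div_assoc,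
    ← sum_div]
  field_simp
  ring

variable {D}

lemma Λ_pos {l : Fin 2 → ℕ} (hl : l ∈ D.Λ.support) : 0 < D.Λ l :=
  lt_of_le_of_ne (D.Λ_nonneg l) (Ne.symm (Finsupp.mem_support_iff.1 hl))

lemma Γ_pos {j : Fin 2} {r : ℕ} (hr : r ∈ (D.Γ j).support) : 0 < D.Γ j r :=
  lt_of_le_of_ne (D.Γ_nonneg j r) (Ne.symm (Finsupp.mem_support_iff.1 hr))

lemma avgVar_pos {j : Fin 2} (h : ∃ l, l j ≠ 0 ∧ 0 < D.Λ l) : 0 < D.avgVar j := by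
  obtain ⟨l, hl, hΛ⟩ := h
  refine sum_pos' (fun l _ => mul_nonneg (Nat.cast_nonneg _) (D.Λ_nonneg l))
    ⟨l, Finsupp.mem_support_iff.2 hΛ.ne', mul_pos ?_ hΛ⟩
  exact_mod_cast Nat.pos_of_ne_zero hl

lemma avgCheck_pos {j : Fin 2} (h : ∃ r, 2 ≤ r ∧ 0 < D.Γ j r) : 0 < D.avgCheck j := by
  obtain ⟨r, hr, hΓ⟩ := h
  refine sum_pos' (fun r _ => mul_nonneg (Nat.cast_nonneg _) (D.Γ_nonneg j r))
    ⟨r, Finsupp.mem_support_iff.2 hΓ.ne', mul_pos ?_ hΓ⟩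
  exact_mod_cast (by omega : 0 < r)

/-- The edge fractions are linear in `σ` and `log (mono u l)` is linear in the `log (u j)`, so the
Lagrange terms split into one contribution for each degree pair. -/
lemma varPart_edgeFrac (hV : ∀ j, 0 < D.avgVar j) (σ : (Fin 2 → ℕ) → ℝ) {u : Fin 2 → ℝ}
    (hu : ∀ j, 0 < u j) :
    D.varPart (D.edgeFrac σ) u =
      ∑ l ∈ D.Λ.support, D.Λ l * (log (1 + mono u l) - σ l * log (mono u l)) := by
  have h : ∀ j, D.avgVar j * D.edgeFrac σ j = ∑ l ∈ D.Λ.support, (l j : ℝ) * D.Λ l * σ l :=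
    fun j => mul_div_cancel₀ _ (hV j).ne'
  simp only [varPart, h, sum_mul]
  rw [sum_comm, ← sum_sub_distrib]
  refine sum_congr rfl fun l _ => ?_
  rw [log_mono hu, mul_sub, mul_sum, mul_sum]
  congr 1
  exact sum_congr rfl fun j _ => by ring

/-- Weak duality for the variable nodes: Gibbs' inequality for each degree pair. Equality holds at
`tilt u`, as `varPart_tilt` shows. -/
lemma sum_binEntropy_le_varPart (hV : ∀ j, 0 < D.avgVar j) {σ : (Fin 2 → ℕ) → ℝ}
    (hσ : ∀ l, 0 ≤ σ l ∧ σ l ≤ 1) {u : Fin 2 → ℝ} (hu : ∀ j, 0 < u j) :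
    ∑ l ∈ D.Λ.support, D.Λ l * binEntropy (σ l) ≤ D.varPart (D.edgeFrac σ) u := by
  rw [varPart_edgeFrac hV σ hu]
  refine sum_le_sum fun l _ => mul_le_mul_of_nonneg_left ?_ (D.Λ_nonneg l)
  linarith [binEntropy_add_mul_log_le (hσ l).1 (hσ l).2 (mono_pos hu l)]

/-- The fraction of ones that belongs to `u`. -/
abbrev tilt (u : Fin 2 → ℝ) (l : Fin 2 → ℕ) : ℝ := mono u l / (1 + mono u l)

lemma tilt_pos {u : Fin 2 → ℝ} (hu : ∀ j, 0 < u j) (l : Fin 2 → ℕ) : 0 < tilt u l :=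
  div_pos (mono_pos hu l) (by linarith [mono_pos hu l])

lemma tilt_lt_one {u : Fin 2 → ℝ} (hu : ∀ j, 0 < u j) (l : Fin 2 → ℕ) : tilt u l < 1 := by
  have := mono_pos hu l
  rw [tilt, div_lt_one (by linarith)]
  linarith

lemma tilt_mem {u : Fin 2 → ℝ} (hu : ∀ j, 0 < u j) (l : Fin 2 → ℕ) :
    0 ≤ tilt u l ∧ tilt u l ≤ 1 :=
  ⟨(tilt_pos hu l).le, (tilt_lt_one hu l).le⟩

lemma varPart_tilt (hV : ∀ j, 0 < D.avgVar j) {u : Fin 2 → ℝ} (hu : ∀ j, 0 < u j) :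
    D.varPart (D.edgeFrac (tilt u)) u = ∑ l ∈ D.Λ.support, D.Λ l * binEntropy (tilt u l) := by
  rw [varPart_edgeFrac hV _ hu]
  refine sum_congr rfl fun l _ => ?_
  rw [← binEntropy_add_mul_log_eq (mono_pos hu l)]
  ring

lemma IsSaddlePoint.eq_edgeFrac {e u v : Fin 2 → ℝ} (h : D.IsSaddlePoint e u v) :
    e = D.edgeFrac (tilt u) := by
  ext j
  rw [← h.var_eq j, edgeFrac, one_div, inv_mul_eq_div]
  congr 1
  exact sum_congr rfl fun l _ => by rw [tilt]; ring

/-- The distribution of half the number of ones at a check node of degree `r` that belongs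
to `v`. -/
abbrev checkTilt (r : ℕ) (v : ℝ) (a : ℕ) : ℝ := qTerm r v a / q r v

lemma checkTilt_pos {r a : ℕ} {v : ℝ} (hv : 0 < v) (ha : a ∈ range (r / 2 + 1)) :
    0 < checkTilt r v a :=
  div_pos (qTerm_pos hv ha) (q_pos r hv)

lemma sum_checkTilt (r : ℕ) {v : ℝ} (hv : 0 < v) :
    ∑ a ∈ range (r / 2 + 1), checkTilt r v a = 1 := by
  rw [← sum_div, ← q_eq_sum, div_self (q_pos r hv).ne']

/-- The left hand side of the check node equation, times the average check degree. -/
lemma mul_sum_check_eq (j : Fin 2) (v : ℝ) :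
    v * ∑ r ∈ (D.Γ j).support, (r : ℝ) * D.Γ j r *
      (((1 + v) ^ (r - 1) - (1 - v) ^ (r - 1)) / ((1 + v) ^ r + (1 - v) ^ r)) =
    ∑ r ∈ (D.Γ j).support, D.Γ j r *
      ∑ a ∈ range (r / 2 + 1), ((2 * a : ℕ) : ℝ) * checkTilt r v a := by
  rw [mul_sum]
  refine sum_congr rfl fun r _ => ?_
  have : ∑ a ∈ range (r / 2 + 1), ((2 * a : ℕ) : ℝ) * checkTilt r v a = v * qDeriv r v / q r v := by
    rw [mul_qDeriv, sum_div]
    exact sum_congr rfl fun a _ => by rw [checkTilt]; ring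
  rw [this, mul_qDeriv_div_q]
  ring

lemma IsSaddlePoint.sum_checkTilt_eq {e u v : Fin 2 → ℝ} (h : D.IsSaddlePoint e u v)
    (hC : ∀ j, 0 < D.avgCheck j) (j : Fin 2) :
    ∑ r ∈ (D.Γ j).support, D.Γ j r *
      ∑ a ∈ range (r / 2 + 1), ((2 * a : ℕ) : ℝ) * checkTilt r (v j) a = D.avgCheck j * e j := by
  rw [← mul_sum_check_eq, ← h.check_eq j]
  have := (hC j).ne'
  field_simp

/-- The exponent of the number of check side words, by the fractions of the check nodes of each
degree that have `2 * a` ones. -/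
def checkEntropy (D : DegreeDist) (j : Fin 2) (p : ℕ → ℕ → ℝ) : ℝ :=
  D.avgVar j / D.avgCheck j * ∑ r ∈ (D.Γ j).support, D.Γ j r *
    ∑ a ∈ range (r / 2 + 1), (negMulLog (p r a) + p r a * log (r.choose (2 * a)))

lemma log_qTerm {r a : ℕ} {v : ℝ} (hv : 0 < v) (ha : a ∈ range (r / 2 + 1)) :
    log (qTerm r v a) = log (r.choose (2 * a)) + ((2 * a : ℕ) : ℝ) * log v := by
  have : 0 < r.choose (2 * a) := Nat.choose_pos (by simp only [mem_range] at ha; omega)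
  rw [qTerm, log_mul (by positivity) (by positivity), log_pow]

/-- For distributions `p` with the prescribed mean number of ones, the duality gap is a nonnegative
combination of the gaps in Gibbs' inequality with the weights `qTerm r v`. Positivity and the
equality case of `checkPart` follow from this. -/
lemma checkPart_eq (hC : ∀ j, 0 < D.avgCheck j) (j : Fin 2) {p : ℕ → ℕ → ℝ} {e : ℝ}
    (he : ∑ r ∈ (D.Γ j).support, D.Γ j r *
      ∑ a ∈ range (r / 2 + 1), ((2 * a : ℕ) : ℝ) * p r a = D.avgCheck j * e) {v : ℝ} (hv : 0 < v) :
    D.checkPart j e v - D.checkEntropy j p =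
      D.avgVar j / D.avgCheck j * ∑ r ∈ (D.Γ j).support, D.Γ j r * (log (q r v) -
        ∑ a ∈ range (r / 2 + 1), (negMulLog (p r a) + p r a * log (qTerm r v a))) := by
  have h1 : ∀ r, ∑ a ∈ range (r / 2 + 1), (negMulLog (p r a) + p r a * log (qTerm r v a)) =
      ∑ a ∈ range (r / 2 + 1), (negMulLog (p r a) + p r a * log (r.choose (2 * a))) +
        (∑ a ∈ range (r / 2 + 1), ((2 * a : ℕ) : ℝ) * p r a) * log v := by
    intro r
    rw [sum_mul, ← sum_add_distrib]
    refine sum_congr rfl fun a ha => ?_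
    rw [log_qTerm hv ha]
    ring
  have h2 : D.avgVar j * e * log v = D.avgVar j / D.avgCheck j * ∑ r ∈ (D.Γ j).support, D.Γ j r *
      ((∑ a ∈ range (r / 2 + 1), ((2 * a : ℕ) : ℝ) * p r a) * log v) := by
    simp only [← mul_assoc]
    rw [← sum_mul, he]
    have := (hC j).ne'
    field_simp
  rw [checkPart, checkEntropy, h2, sub_sub, ← mul_add, ← mul_sub, ← sum_add_distrib,
    ← sum_sub_distrib]
  congr 1
  refine sum_congr rfl fun r _ => ?_
  rw [h1]
  ring

/-- The check equation makes the tilt by `v j` feasible, and a feasible distribution has a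
nonnegative gap at every `v'`. -/
lemma IsSaddlePoint.checkEntropy_le (hV : ∀ j, 0 < D.avgVar j) (hC : ∀ j, 0 < D.avgCheck j)
    {e u v : Fin 2 → ℝ} (h : D.IsSaddlePoint e u v) (j : Fin 2) {v' : ℝ} (hv' : 0 < v') :
    D.checkEntropy j (fun r => checkTilt r (v j)) ≤ D.checkPart j (e j) v' := by
  have h1 := checkPart_eq hC j (p := fun r => checkTilt r (v j)) (h.sum_checkTilt_eq hC j) hv'
  rw [← sub_nonneg, h1]
  refine mul_nonneg (div_pos (hV j) (hC j)).le (sum_nonneg fun r _ =>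
    mul_nonneg (D.Γ_nonneg j r) (sub_nonneg.2 ?_))
  rw [q_eq_sum]
  exact sum_negMulLog_add_le _ _ _ (fun a ha => (checkTilt_pos (h.v_pos j) ha).le)
    (sum_checkTilt r (h.v_pos j)) (fun a ha => qTerm_pos hv' ha)

lemma IsSaddlePoint.checkPart_eq_checkEntropy (hC : ∀ j, 0 < D.avgCheck j)
    {e u v : Fin 2 → ℝ} (h : D.IsSaddlePoint e u v) (j : Fin 2) :
    D.checkPart j (e j) (v j) = D.checkEntropy j (fun r => checkTilt r (v j)) := by
  have h1 := checkPart_eq hC j (p := fun r => checkTilt r (v j)) (h.sum_checkTilt_eq hC j)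
    (h.v_pos j)
  rw [← sub_eq_zero, h1]
  refine mul_eq_zero_of_right _ (sum_eq_zero fun r _ => mul_eq_zero_of_right _ (sub_eq_zero.2 ?_))
  simp only [checkTilt, q_eq_sum]
  exact (sum_negMulLog_add_eq _ _ (fun a ha => qTerm_pos (h.v_pos j) ha) (by simp)).symm

/-- A positive solution of the saddle point equations minimizes `thetaExpr`. -/
lemma IsSaddlePoint.thetaExpr_le (hV : ∀ j, 0 < D.avgVar j) (hC : ∀ j, 0 < D.avgCheck j)
    {e u v : Fin 2 → ℝ} (h : D.IsSaddlePoint e u v) {u' v' : Fin 2 → ℝ} (hu' : ∀ j, 0 < u' j)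
    (hv' : ∀ j, 0 < v' j) : D.thetaExpr e u v ≤ D.thetaExpr e u' v' := by
  have h1 : D.varPart e u ≤ D.varPart e u' := by
    rw [h.eq_edgeFrac, varPart_tilt hV h.u_pos]
    exact sum_binEntropy_le_varPart hV (tilt_mem h.u_pos) hu'
  have h2 : ∑ j, D.checkPart j (e j) (v j) ≤ ∑ j, D.checkPart j (e j) (v' j) :=
    sum_le_sum fun j _ => by
      rw [h.checkPart_eq_checkEntropy hC]
      exact h.checkEntropy_le hV hC j (hv' j)
  have h3 := D.thetaExpr_add_designRate e u v
  have h4 := D.thetaExpr_add_designRate e u' v'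
  have h5 : 0 < log 2 := log_pos one_lt_two
  have h6 : (D.thetaExpr e u v + D.designRate) * log 2 ≤ (D.thetaExpr e u' v' + D.designRate) * log 2 := by
    rw [h3, h4]; linarith
  linarith [le_of_mul_le_mul_right h6 h5]

/-- Two solutions both minimize the same function, so their values agree. Uniqueness of the
solutions themselves is not needed. -/
lemma IsTheta.unique (hV : ∀ j, 0 < D.avgVar j) (hC : ∀ j, 0 < D.avgCheck j) {e : Fin 2 → ℝ}
    {t t' : ℝ} (h : D.IsTheta e t) (h' : D.IsTheta e t') : t = t' := by
  obtain ⟨u, v, hs, rfl⟩ := h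
  obtain ⟨u', v', hs', rfl⟩ := h'
  exact le_antisymm (hs.thetaExpr_le hV hC hs'.u_pos hs'.v_pos)
    (hs'.thetaExpr_le hV hC hs.u_pos hs.v_pos)

end DegreeDist

end TwoEdgeLDPC

end

/-! ### Existence of saddle points, and finiteness of the supremum -/

noncomputable section

namespace TwoEdgeLDPC

open Finset Real

lemma isMinOn_of_le_subset_compact {X : Type*} [TopologicalSpace X] {f : X → ℝ} {s K : Set X}
    {x₀ : X} (hf : Continuous f) (hs : IsClosed s) (h0 : x₀ ∈ s) (hK : IsCompact K)
    (h : ∀ x, f x < f x₀ → x ∈ K) : ∃ x ∈ s, IsMinOn f s x := by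
  refine hf.continuousOn.exists_isMinOn' hs h0 (Filter.Eventually.filter_mono inf_le_left ?_)
  filter_upwards [hK.compl_mem_cocompact] with x hx
  by_contra hlt
  exact hx (h x (not_le.1 hlt))

/-- Both `0` and `x` are lower bounds of `log (1 + exp x)`. For `0 < σ < 1` this gives coercivity.
-/
lemma mul_abs_le_log_one_add_exp_sub (σ x : ℝ) :
    min σ (1 - σ) * |x| ≤ log (1 + exp x) - σ * x := by
  have hx : x ≤ log (1 + exp x) := by
    rw [le_log_iff_exp_le (by positivity)]; linarith
  have h0 : 0 ≤ log (1 + exp x) := log_nonneg (by linarith [exp_pos x])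
  rcases le_total 0 x with h | h
  · rw [abs_of_nonneg h]
    nlinarith [mul_le_mul_of_nonneg_right (min_le_right σ (1 - σ)) h]
  · rw [abs_of_nonpos h]
    nlinarith [mul_le_mul_of_nonneg_right (min_le_left σ (1 - σ)) (neg_nonneg.2 h)]

namespace DegreeDist

variable {D : DegreeDist}

/-- The variable equations are the stationarity conditions of `F ∘ T` in the coordinates `s j = log
(u j)`, so a minimizer solves them. -/
lemma exists_tilt_eq (σ : (Fin 2 → ℕ) → ℝ) (hσ : ∀ l, 0 < σ l ∧ σ l < 1) :
    ∃ u : Fin 2 → ℝ, (∀ j, 0 < u j) ∧ D.edgeFrac (tilt u) = D.edgeFrac σ := by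
  classical
  let T : (Fin 2 → ℝ) →ₗ[ℝ] (D.Λ.support → ℝ) :=
    LinearMap.pi fun l => ∑ j, (l.1 j : ℝ) • LinearMap.proj j
  have hT : ∀ s l, T s l = ∑ j, (l.1 j : ℝ) * s j := by
    intro s l
    simp [T]
  let F : (D.Λ.support → ℝ) → ℝ :=
    fun x => ∑ l, D.Λ l.1 * (log (1 + exp (x l)) - σ l.1 * x l)
  have hF : Continuous F := by
    refine continuous_finsetSum _ fun l _ => continuous_const.mul (Continuous.sub ?_ ?_)
    · exact Continuous.log (by fun_prop) fun x => (by positivity)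
    · fun_prop
  let c : D.Λ.support → ℝ := fun l => D.Λ l.1 * min (σ l.1) (1 - σ l.1)
  have hc : ∀ l, 0 < c l := fun l =>
    mul_pos (Λ_pos l.2) (lt_min (hσ l.1).1 (by linarith [(hσ l.1).2]))
  have hterm : ∀ (l : D.Λ.support) (x : ℝ),
      c l * |x| ≤ D.Λ l.1 * (log (1 + exp x) - σ l.1 * x) := fun l x => by
    rw [mul_assoc]
    exact mul_le_mul_of_nonneg_left (mul_abs_le_log_one_add_exp_sub _ _) (D.Λ_nonneg _)
  have hcoer : ∀ x l, c l * |x l| ≤ F x := fun x l =>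
    (hterm l (x l)).trans (single_le_sum (f := fun l : D.Λ.support => D.Λ l.1 * (log (1 + exp (x l)) - σ l.1 * x l))
      (fun l _ => (mul_nonneg (hc l).le (abs_nonneg _)).trans (hterm l (x l))) (mem_univ l))
  -- The minimum is taken over the range of `T`, a closed subspace, rather than over `s`: `T` can
  -- have a kernel, and `F ∘ T` is constant along it.
  obtain ⟨x, ⟨s, rfl⟩, hmin⟩ := isMinOn_of_le_subset_compact (s := (T.range : Set _)) (x₀ := 0)
    (K := Set.univ.pi fun l => Set.Icc (-(F 0 / c l)) (F 0 / c l)) hF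
    (Submodule.closed_of_finiteDimensional _) (Submodule.zero_mem _)
    (isCompact_univ_pi fun _ => isCompact_Icc) (by
      intro x hx l _
      rw [Set.mem_Icc, ← abs_le, le_div_iff₀' (hc l)]
      exact (hcoer x l).trans hx.le)
  refine ⟨fun j => exp (s j), fun j => exp_pos _, ?_⟩
  have hmono : ∀ l : D.Λ.support, mono (fun j => exp (s j)) l.1 = exp (T s l) := by
    intro l
    rw [mono, hT, Fin.sum_univ_two, exp_add, exp_nat_mul, exp_nat_mul]
  ext j
  have hder : HasDerivAt (fun t : ℝ => F (T (s + t • Pi.single j 1)))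
      (∑ l : D.Λ.support, D.Λ l.1 * (exp (T s l) * l.1 j / (1 + exp (T s l)) - σ l.1 * l.1 j)) 0 := by
    refine HasDerivAt.fun_sum fun l _ => HasDerivAt.const_mul _ ?_
    have h1 : HasDerivAt (fun t : ℝ => T (s + t • Pi.single j 1) l) (l.1 j : ℝ) 0 := by
      have : ∀ t : ℝ, T (s + t • Pi.single j 1) l = T s l + t * l.1 j := by
        intro t
        rw [map_add, map_smul]
        simp only [Pi.add_apply, Pi.smul_apply, smul_eq_mul, hT (Pi.single j 1)]
        simp [Pi.single_apply]
      simp only [this]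
      simpa using ((hasDerivAt_id (0 : ℝ)).mul_const (l.1 j : ℝ)).const_add (T s l)
    have h2 := ((h1.exp.const_add 1).log (by positivity)).fun_sub (h1.const_mul (σ l.1))
    simpa using h2
  have hlm : IsLocalMin (fun t : ℝ => F (T (s + t • Pi.single j 1))) 0 := by
    refine Filter.Eventually.of_forall fun t => ?_
    have := hmin (show T (s + t • Pi.single j 1) ∈ (T.range : Set _) from ⟨_, rfl⟩)
    simpa using this
  have hz := hlm.hasDerivAt_eq_zero hder
  rw [edgeFrac, edgeFrac]
  congr 1
  rw [← sub_eq_zero, ← sum_sub_distrib, ← sum_coe_sort, ← hz]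
  refine sum_congr rfl fun l _ => ?_
  rw [tilt, hmono]
  ring

/-- The largest possible average number of ones at a check node of type `j`. -/
def checkCap (D : DegreeDist) (j : Fin 2) : ℝ :=
  ∑ r ∈ (D.Γ j).support, D.Γ j r * ((2 * (r / 2) : ℕ) : ℝ)

lemma log_q_nonneg (r : ℕ) {v : ℝ} (hv : 0 < v) : 0 ≤ log (q r v) := by
  refine log_nonneg ?_
  rw [q_eq_sum]
  calc (1 : ℝ) = qTerm r v 0 := by simp [qTerm]
    _ ≤ _ := single_le_sum (f := qTerm r v) (fun a ha => (qTerm_pos hv ha).le) (by simp)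

lemma mul_log_le_log_q (r : ℕ) {v : ℝ} (hv : 0 < v) :
    ((2 * (r / 2) : ℕ) : ℝ) * log v ≤ log (q r v) := by
  rw [← log_pow]
  refine log_le_log (by positivity) ?_
  rw [q_eq_sum]
  have h1 : (1 : ℝ) ≤ r.choose (2 * (r / 2)) := by
    exact_mod_cast Nat.choose_pos (by omega)
  calc v ^ (2 * (r / 2)) ≤ qTerm r v (r / 2) := by
        rw [qTerm]; exact le_mul_of_one_le_left (by positivity) h1
    _ ≤ _ := single_le_sum (f := qTerm r v) (fun a ha => (qTerm_pos hv ha).le) (by simp)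

/-- With `v = exp y`, the equation says that the derivative of `F` vanishes. The lowest and the
highest term of `q r` bound `F` below by linear functions of negative and positive slope, because
the prescribed mean lies strictly between zero and the cap. Hence `F` has a minimum. -/
lemma exists_check_eq (j : Fin 2) (hC : 0 < D.avgCheck j) {e : ℝ} (he : 0 < e)
    (hcap : D.avgCheck j * e < D.checkCap j) :
    ∃ v, 0 < v ∧ v / D.avgCheck j * ∑ r ∈ (D.Γ j).support, (r : ℝ) * D.Γ j r *
      (((1 + v) ^ (r - 1) - (1 - v) ^ (r - 1)) / ((1 + v) ^ r + (1 - v) ^ r)) = e := by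
  let F : ℝ → ℝ := fun y =>
    ∑ r ∈ (D.Γ j).support, D.Γ j r * log (q r (exp y)) - D.avgCheck j * e * y
  have hder : ∀ y, HasDerivAt F (∑ r ∈ (D.Γ j).support,
      D.Γ j r * (qDeriv r (exp y) * exp y / q r (exp y)) - D.avgCheck j * e) y := by
    intro y
    refine (HasDerivAt.fun_sum fun r _ => HasDerivAt.const_mul _ ?_).sub ?_
    · exact ((hasDerivAt_q r (exp y)).comp y (Real.hasDerivAt_exp y)).log (q_pos r (exp_pos y)).ne'
    · simpa using (hasDerivAt_id y).const_mul (D.avgCheck j * e)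
  have hF : Continuous F := continuous_iff_continuousAt.2 fun y => (hder y).continuousAt
  have hAe : 0 < D.avgCheck j * e := mul_pos hC he
  have h1 : ∀ y, -(D.avgCheck j * e * y) ≤ F y := by
    intro y
    have : 0 ≤ ∑ r ∈ (D.Γ j).support, D.Γ j r * log (q r (exp y)) :=
      sum_nonneg fun r _ => mul_nonneg (D.Γ_nonneg j r) (log_q_nonneg r (exp_pos y))
    simp only [F]; linarith
  have h2 : ∀ y, (D.checkCap j - D.avgCheck j * e) * y ≤ F y := by
    intro y
    have : D.checkCap j * y ≤ ∑ r ∈ (D.Γ j).support, D.Γ j r * log (q r (exp y)) := by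
      rw [checkCap, sum_mul]
      refine sum_le_sum fun r _ => ?_
      rw [mul_assoc]
      refine mul_le_mul_of_nonneg_left ?_ (D.Γ_nonneg j r)
      simpa using mul_log_le_log_q r (exp_pos y)
    simp only [F]; linarith
  have hd : 0 < D.checkCap j - D.avgCheck j * e := by linarith
  obtain ⟨y, -, hmin⟩ := isMinOn_of_le_subset_compact (s := Set.univ) (x₀ := 0)
    (K := Set.Icc (-(F 0 / (D.avgCheck j * e))) (F 0 / (D.checkCap j - D.avgCheck j * e))) hF
    isClosed_univ (Set.mem_univ _) isCompact_Icc (by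
      intro y hy
      constructor
      · rw [neg_le, le_div_iff₀' hAe]; linarith [h1 y]
      · rw [le_div_iff₀' hd]; linarith [h2 y])
  refine ⟨exp y, exp_pos y, ?_⟩
  have hz := (hmin.isLocalMin Filter.univ_mem).hasDerivAt_eq_zero (hder y)
  have h3 : exp y * ∑ r ∈ (D.Γ j).support, (r : ℝ) * D.Γ j r *
      (((1 + exp y) ^ (r - 1) - (1 - exp y) ^ (r - 1)) / ((1 + exp y) ^ r + (1 - exp y) ^ r)) =
      D.avgCheck j * e := by
    rw [← sub_eq_zero, ← hz, mul_sum]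
    congr 1
    refine sum_congr rfl fun r _ => ?_
    rw [mul_comm (qDeriv r (exp y)), mul_qDeriv_div_q]
    ring
  rw [div_mul_eq_mul_div, h3, mul_div_cancel_left₀ _ hC.ne']

lemma edgeFrac_pos (hV : ∀ j, 0 < D.avgVar j) {σ : (Fin 2 → ℕ) → ℝ} (hσ : ∀ l, 0 < σ l)
    (j : Fin 2) : 0 < D.edgeFrac σ j := by
  refine div_pos ?_ (hV j)
  have h : 0 < ∑ l ∈ D.Λ.support, (l j : ℝ) * D.Λ l := hV j
  obtain ⟨l, hl, hlt⟩ := exists_lt_of_sum_lt (by simpa using h :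
    ∑ l ∈ D.Λ.support, (0 : ℝ) < ∑ l ∈ D.Λ.support, (l j : ℝ) * D.Λ l)
  exact sum_pos' (fun l _ => mul_nonneg (mul_nonneg (Nat.cast_nonneg _) (D.Λ_nonneg l)) (hσ l).le)
    ⟨l, hl, mul_pos hlt (hσ l)⟩

/-- For a given e the equations for `u` and for each `v j` decouple. -/
lemma exists_isSaddlePoint (hV : ∀ j, 0 < D.avgVar j) (hC : ∀ j, 0 < D.avgCheck j)
    {σ : (Fin 2 → ℕ) → ℝ} (hσ : ∀ l, 0 < σ l ∧ σ l < 1)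
    (hcap : ∀ j, D.avgCheck j * D.edgeFrac σ j < D.checkCap j) :
    ∃ u v, D.IsSaddlePoint (D.edgeFrac σ) u v := by
  obtain ⟨u, hu, hue⟩ := exists_tilt_eq (D := D) σ hσ
  choose v hv hve using fun j =>
    exists_check_eq j (hC j) (edgeFrac_pos hV (fun l => (hσ l).1) j) (hcap j)
  refine ⟨u, v, hu, hv, hve, fun j => ?_⟩
  rw [← hue, edgeFrac, one_div, inv_mul_eq_div]
  congr 1
  exact sum_congr rfl fun l _ => by rw [tilt]; ring

lemma checkCap_pos {j : Fin 2} (h : ∃ r, 2 ≤ r ∧ 0 < D.Γ j r) : 0 < D.checkCap j := by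
  obtain ⟨r, hr, hΓ⟩ := h
  refine sum_pos' (fun r _ => mul_nonneg (D.Γ_nonneg j r) (Nat.cast_nonneg _))
    ⟨r, Finsupp.mem_support_iff.2 hΓ.ne', mul_pos hΓ ?_⟩
  exact_mod_cast (by omega : 0 < 2 * (r / 2))

lemma edgeFrac_const (hV : ∀ j, 0 < D.avgVar j) (c : ℝ) (j : Fin 2) :
    D.edgeFrac (fun _ => c) j = c := by
  rw [edgeFrac, ← sum_mul]
  exact mul_div_cancel_left₀ _ (hV j).ne'

/-- A constant `σ = c` gives `e j = c` for both types, hence an interior reference point strictly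
below both caps. -/
lemma exists_const (hC : ∀ j, 0 < D.avgCheck j) (hcap : ∀ j, 0 < D.checkCap j) :
    ∃ c : ℝ, 0 < c ∧ c < 1 ∧ ∀ j, D.avgCheck j * c < D.checkCap j := by
  have h : ∀ j, 0 < D.checkCap j / D.avgCheck j := fun j => div_pos (hcap j) (hC j)
  obtain ⟨c, hc0, hc⟩ := exists_between
    (lt_min one_pos (lt_min (h 0) (h 1)) : (0 : ℝ) < _)
  simp only [lt_min_iff] at hc
  refine ⟨c, hc0, hc.1, fun j => ?_⟩
  rw [← lt_div_iff₀' (hC j)]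
  fin_cases j
  · exact hc.2.1
  · exact hc.2.2

lemma edgeFrac_mem_region {σ : (Fin 2 → ℕ) → ℝ} (hσ : ∀ l, 0 ≤ σ l ∧ σ l ≤ 1) :
    D.edgeFrac σ ∈ D.region := ⟨σ, hσ, fun _ => rfl⟩

lemma isTheta_nonempty (hV : ∀ j, 0 < D.avgVar j) (hC : ∀ j, 0 < D.avgCheck j)
    (hcap : ∀ j, 0 < D.checkCap j) : {t | ∃ e ∈ D.region, D.IsTheta e t}.Nonempty := by
  obtain ⟨c, h0, h1, hc⟩ := exists_const hC hcap
  obtain ⟨u, v, h⟩ := exists_isSaddlePoint hV hC (σ := fun _ => c) (fun _ => ⟨h0, h1⟩)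
    (fun j => by rw [edgeFrac_const hV]; exact hc j)
  exact ⟨_, _, edgeFrac_mem_region fun _ => ⟨h0.le, h1.le⟩, u, v, h, rfl⟩

lemma edgeFrac_mem_Icc (hV : ∀ j, 0 < D.avgVar j) {σ : (Fin 2 → ℕ) → ℝ}
    (hσ : ∀ l, 0 ≤ σ l ∧ σ l ≤ 1) (j : Fin 2) : D.edgeFrac σ j ∈ Set.Icc (0 : ℝ) 1 := by
  have hn : ∀ l : Fin 2 → ℕ, 0 ≤ (l j : ℝ) * D.Λ l := fun l =>
    mul_nonneg (Nat.cast_nonneg _) (D.Λ_nonneg l)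
  refine ⟨div_nonneg (sum_nonneg fun l _ => mul_nonneg (hn l) (hσ l).1) (hV j).le, ?_⟩
  rw [edgeFrac, div_le_one (hV j)]
  exact sum_le_sum fun l _ => mul_le_of_le_one_right (hn l) (hσ l).2

/-- By minimality, θ is at most the expression at `u = v = 1`. There all logarithms that multiply `e
j` vanish, and the subtracted entropies are nonnegative. -/
lemma isTheta_bddAbove (hV : ∀ j, 0 < D.avgVar j) (hC : ∀ j, 0 < D.avgCheck j) :
    BddAbove {t | ∃ e ∈ D.region, D.IsTheta e t} := by
  have h2 : 0 < log 2 := log_pos one_lt_two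
  refine ⟨(∑ l ∈ D.Λ.support, D.Λ l * log 2 + ∑ j, D.checkPart j 0 1) / log 2 - D.designRate, ?_⟩
  rintro t ⟨e, -, u, v, h, rfl⟩
  refine (h.thetaExpr_le hV hC (u' := fun _ => 1) (v' := fun _ => 1) (fun _ => one_pos)
    fun _ => one_pos).trans ?_
  rw [le_sub_iff_add_le, le_div_iff₀ h2, thetaExpr_add_designRate]
  have h3 : ∀ j, 0 ≤ D.avgVar j * binEntropy (e j) := fun j => by
    rw [h.eq_edgeFrac]
    have := edgeFrac_mem_Icc hV (tilt_mem h.u_pos) j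
    exact mul_nonneg (hV j).le (binEntropy_nonneg this.1 this.2)
  have h4 : 0 ≤ ∑ j, D.avgVar j * binEntropy (e j) := sum_nonneg fun j _ => h3 j
  have h5 : D.varPart e (fun _ => 1) = ∑ l ∈ D.Λ.support, D.Λ l * log 2 := by
    simp [varPart, mono, one_add_one_eq_two]
  have h6 : ∀ j, D.checkPart j (e j) 1 = D.checkPart j 0 1 := fun j => by simp [checkPart]
  simp only [h5, h6]
  linarith

end DegreeDist

end TwoEdgeLDPC

end

/-! ### Stirling asymptotics of factorials, binomial and multinomial coefficients -/

noncomputable section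

namespace TwoEdgeLDPC

open Finset Real Filter Topology

/-- The Stirling sequence decreases, so it is bounded by its first term. Only an error of
logarithmic size matters. -/
lemma log_factorial_le (n : ℕ) :
    log (n.factorial) ≤ n * log n - n + log (n + 1) + 1 := by
  rcases n with _ | n
  · simp
  · have h1 := Stirling.log_stirlingSeq_formula (n + 1)
    have h2 : log (Stirling.stirlingSeq (n + 1)) ≤ log (Stirling.stirlingSeq 1) :=
      Stirling.log_stirlingSeq'_antitone (Nat.zero_le n)
    rw [Stirling.stirlingSeq_one, log_div (exp_pos 1).ne' (by positivity), log_exp,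
      log_sqrt (by norm_num)] at h2
    have hn : (0 : ℝ) < ((n + 1 : ℕ) : ℝ) := by positivity
    rw [log_mul two_ne_zero hn.ne', log_div hn.ne' (exp_pos 1).ne', log_exp] at h1
    have h3 : log ((n + 1 : ℕ) : ℝ) ≤ log (((n + 1 : ℕ) : ℝ) + 1) := log_le_log hn (by linarith)
    have h4 : 0 ≤ log ((n + 1 : ℕ) : ℝ) := log_natCast_nonneg _
    linarith

lemma le_log_factorial (n : ℕ) : n * log n - n ≤ log (n.factorial) := by
  rcases Nat.eq_zero_or_pos n with rfl | hn
  · simp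
  · have h := Stirling.le_log_factorial_stirling hn.ne'
    have h4 : 0 ≤ log (n : ℝ) := log_natCast_nonneg _
    have h5 : 0 ≤ log (2 * π) := log_nonneg (by linarith [pi_gt_three])
    linarith

section Asymptotics

variable {ι : Type*} {F : Filter ι} {N : ι → ℕ}

lemma tendsto_log_add_one_div (hN : Tendsto (fun i => (N i : ℝ)) F atTop) {a : ι → ℕ} {α : ℝ}
    (ha : Tendsto (fun i => (a i : ℝ) / N i) F (𝓝 α)) :
    Tendsto (fun i => log (a i + 1) / N i) F (𝓝 0) := by
  have hinv : Tendsto (fun i => (N i : ℝ)⁻¹) F (𝓝 0) := tendsto_inv_atTop_zero.comp hN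
  have h1 : Tendsto (fun i => 2 * √(((a i : ℝ) / N i + (N i : ℝ)⁻¹) * (N i : ℝ)⁻¹)) F (𝓝 0) := by
    have := (((ha.add hinv).mul hinv).sqrt).const_mul 2
    simpa using this
  refine squeeze_zero (fun i => ?_) (fun i => ?_) h1
  · exact div_nonneg (log_nonneg (by linarith [Nat.cast_nonneg (α := ℝ) (a i)])) (Nat.cast_nonneg _)
  · have h2 : ((a i : ℝ) / N i + (N i : ℝ)⁻¹) * (N i : ℝ)⁻¹ = (a i + 1) / (N i) ^ 2 := by
      ring
    have hp : (0 : ℝ) < a i + 1 := by positivity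
    rw [h2, sqrt_div hp.le, sqrt_sq (Nat.cast_nonneg _), ← mul_div_assoc]
    refine div_le_div_of_nonneg_right ?_ (Nat.cast_nonneg _)
    have h3 : log (a i + 1) = 2 * log (√(a i + 1)) := by
      rw [log_sqrt hp.le]; ring
    rw [h3]
    exact mul_le_mul_of_nonneg_left (log_le_self (sqrt_nonneg _)) two_pos.le

/-- The subtracted `a log N - a` is additive in `a`, so it cancels in binomial and multinomial
coefficients. Continuity of `negMulLog` at zero covers the limit `α = 0`. -/
lemma tendsto_log_factorial (hN : Tendsto (fun i => (N i : ℝ)) F atTop) {a : ι → ℕ} {α : ℝ}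
    (ha : Tendsto (fun i => (a i : ℝ) / N i) F (𝓝 α)) :
    Tendsto (fun i => (log ((a i).factorial) - a i * log (N i) + a i) / N i) F
      (𝓝 (-negMulLog α)) := by
  have h0 : Tendsto (fun i => -negMulLog ((a i : ℝ) / N i)) F (𝓝 (-negMulLog α)) :=
    ((continuous_negMulLog.tendsto α).comp ha).neg
  have hinv : Tendsto (fun i => (N i : ℝ)⁻¹) F (𝓝 0) := tendsto_inv_atTop_zero.comp hN
  have h1 : Tendsto (fun i => -negMulLog ((a i : ℝ) / N i) +
      (log (a i + 1) / N i + (N i : ℝ)⁻¹)) F (𝓝 (-negMulLog α)) := by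
    have := h0.add ((tendsto_log_add_one_div hN ha).add hinv)
    simpa using this
  have key : ∀ᶠ i in F, -negMulLog ((a i : ℝ) / N i) = (a i * log (a i) - a i * log (N i)) / N i := by
    filter_upwards [hN.eventually_gt_atTop 0] with i hi
    rcases Nat.eq_zero_or_pos (a i) with h | h
    · simp [h]
    · have : (0 : ℝ) < a i := by exact_mod_cast h
      rw [negMulLog, log_div this.ne' hi.ne']
      ring
  refine tendsto_of_tendsto_of_tendsto_of_le_of_le' h0 h1 ?_ ?_
  · filter_upwards [key] with i hi
    rw [hi]
    exact div_le_div_of_nonneg_right (by linarith [le_log_factorial (a i)]) (Nat.cast_nonneg _)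
  · filter_upwards [key] with i hi
    rw [hi, ← one_div, ← add_div, ← add_div]
    exact div_le_div_of_nonneg_right (by linarith [log_factorial_le (a i)]) (Nat.cast_nonneg _)

lemma tendsto_log_choose (hN : Tendsto (fun i => (N i : ℝ)) F atTop) {a b : ι → ℕ} {α s : ℝ}
    (ha : Tendsto (fun i => (a i : ℝ) / N i) F (𝓝 α))
    (hb : Tendsto (fun i => (b i : ℝ) / N i) F (𝓝 (α * s))) (hba : ∀ i, b i ≤ a i) :
    Tendsto (fun i => log ((a i).choose (b i)) / N i) F (𝓝 (α * binEntropy s)) := by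
  have hc : Tendsto (fun i => ((a i - b i : ℕ) : ℝ) / N i) F (𝓝 (α * (1 - s))) := by
    have := ha.sub hb
    rw [mul_sub, mul_one]
    refine this.congr fun i => ?_
    rw [Nat.cast_sub (hba i), sub_div]
  have h := ((tendsto_log_factorial hN ha).sub (tendsto_log_factorial hN hb)).sub
    (tendsto_log_factorial hN hc)
  have hlim : -negMulLog α - -negMulLog (α * s) - -negMulLog (α * (1 - s)) = α * binEntropy s := by
    rw [negMulLog_mul, negMulLog_mul, binEntropy_eq_negMulLog_add_negMulLog_one_sub]
    ring
  rw [hlim] at h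
  refine h.congr fun i => ?_
  rw [Nat.cast_choose ℝ (hba i), log_div (by positivity) (by positivity),
    log_mul (by positivity) (by positivity), Nat.cast_sub (hba i)]
  ring

lemma tendsto_log_multinomial (hN : Tendsto (fun i => (N i : ℝ)) F atTop) {κ : Type*}
    (s : Finset κ) {t : ι → κ → ℕ} {μ : ℝ} {p : κ → ℝ} (hp : ∑ a ∈ s, p a = 1)
    (ht : ∀ a ∈ s, Tendsto (fun i => (t i a : ℝ) / N i) F (𝓝 (μ * p a))) :
    Tendsto (fun i => log (Nat.multinomial s (t i)) / N i) F
      (𝓝 (μ * ∑ a ∈ s, negMulLog (p a))) := by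
  have hsum : Tendsto (fun i => ((∑ a ∈ s, t i a : ℕ) : ℝ) / N i) F (𝓝 μ) := by
    have := tendsto_finsetSum s ht
    rw [← mul_sum, hp, mul_one] at this
    refine this.congr fun i => ?_
    rw [Nat.cast_sum, sum_div]
  have h := (tendsto_log_factorial hN hsum).sub
    (tendsto_finsetSum s fun a ha => tendsto_log_factorial hN (ht a ha))
  have hlim : -negMulLog μ - ∑ a ∈ s, -negMulLog (μ * p a) = μ * ∑ a ∈ s, negMulLog (p a) := by
    simp only [negMulLog_mul, neg_add, sum_add_distrib, sum_neg_distrib, ← sum_mul, hp, ← mul_sum]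
    ring
  rw [hlim] at h
  refine h.congr fun i => ?_
  have hspec := congrArg (fun n : ℕ => log (n : ℝ)) (Nat.multinomial_spec s (t i))
  simp only [Nat.cast_mul, Nat.cast_prod] at hspec
  rw [log_mul (prod_ne_zero_iff.2 fun a _ => by positivity)
    (by exact_mod_cast (Nat.multinomial_pos s (t i)).ne'),
    log_prod fun a _ => by positivity] at hspec
  rw [← hspec, ← sum_div, ← sub_div, sum_add_distrib, sum_sub_distrib, ← sum_mul, Nat.cast_sum]
  ring

lemma tendsto_floor_div (hN : Tendsto (fun i => (N i : ℝ)) F atTop) {x : ι → ℝ} {ξ : ℝ}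
    (hx0 : ∀ i, 0 ≤ x i) (hx : Tendsto (fun i => x i / N i) F (𝓝 ξ)) :
    Tendsto (fun i => (⌊x i⌋₊ : ℝ) / N i) F (𝓝 ξ) := by
  have hinv : Tendsto (fun i => (N i : ℝ)⁻¹) F (𝓝 0) := tendsto_inv_atTop_zero.comp hN
  have h1 : Tendsto (fun i => x i / N i - (N i : ℝ)⁻¹) F (𝓝 ξ) := by simpa using hx.sub hinv
  refine tendsto_of_tendsto_of_tendsto_of_le_of_le h1 hx (fun i => ?_) fun i => ?_
  · simp only
    rw [← one_div, ← sub_div]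
    exact div_le_div_of_nonneg_right (by linarith [Nat.lt_floor_add_one (x i)]) (Nat.cast_nonneg _)
  · exact div_le_div_of_nonneg_right (Nat.floor_le (hx0 i)) (Nat.cast_nonneg _)

/-! ### Integral types near a given distribution -/

lemma sum_sum_ite_add {M : Type*} [AddCommMonoid M] (s : Finset ℕ) (T : ℕ → Finset ℕ)
    {r₀ a₀ : ℕ} (hr : r₀ ∈ s) (ha : a₀ ∈ T r₀) (g : ℕ → ℕ → M) :
    ∑ r ∈ s, ∑ a ∈ T r, (if r = r₀ ∧ a = a₀ then 0 else g r a) + g r₀ a₀ =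
      ∑ r ∈ s, ∑ a ∈ T r, g r a := by
  have h : ∑ r ∈ s, ∑ a ∈ T r, (if r = r₀ ∧ a = a₀ then g r a else 0) = g r₀ a₀ := by
    rw [sum_eq_single_of_mem r₀ hr, sum_eq_single_of_mem a₀ ha]
    · simp
    · intro b _ hb; simp [hb]
    · intro b _ hb; simp [hb]
  rw [← h, ← sum_add_distrib]
  refine sum_congr rfl fun r _ => ?_
  rw [← sum_add_distrib]
  refine sum_congr rfl fun a _ => ?_
  split_ifs <;> simp

/-- Integral types that approximate given distributions and have a prescribed even number of
ones. -/
lemma exists_approx_type (hN : Tendsto (fun i => (N i : ℝ)) F atTop) (s : Finset ℕ)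
    {m : ι → ℕ → ℕ} {μ : ℕ → ℝ} {p : ℕ → ℕ → ℝ} {W : ι → ℕ} {ω : ℝ}
    (hm : ∀ r ∈ s, Tendsto (fun i => (m i r : ℝ) / N i) F (𝓝 (μ r)))
    (hμ : ∀ r ∈ s, 0 < μ r) (hp : ∀ r, ∀ a ∈ range (r / 2 + 1), 0 < p r a)
    (hsum : ∀ r, ∑ a ∈ range (r / 2 + 1), p r a = 1)
    (hW : Tendsto (fun i => (W i : ℝ) / N i) F (𝓝 ω)) (heven : ∀ i, Even (W i))
    (hω : ∑ r ∈ s, μ r * ∑ a ∈ range (r / 2 + 1), ((2 * a : ℕ) : ℝ) * p r a = ω)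
    {r₀ : ℕ} (hr₀ : r₀ ∈ s) (h2 : 2 ≤ r₀) :
    ∃ t : ι → ℕ → ℕ → ℕ,
      (∀ r ∈ s, ∀ a ∈ range (r / 2 + 1),
        Tendsto (fun i => (t i r a : ℝ) / N i) F (𝓝 (μ r * p r a))) ∧
      ∀ᶠ i in F, (∀ r ∈ s, ∑ a ∈ range (r / 2 + 1), t i r a = m i r) ∧
        ∑ r ∈ s, ∑ a ∈ range (r / 2 + 1), 2 * a * t i r a = W i := by
  classical
  have h1mem : 1 ∈ range (r₀ / 2 + 1) := by simp only [mem_range]; omega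
  -- Rounding down spoils the total weight and the row sums. The entry `(r₀, 1)` repairs the weight:
  -- it counts checks with two ones and `W - R` is even. The entries `a = 0` then repair the row
  -- sums without changing the weight.
  let x : ι → ℕ → ℕ → ℕ := fun i r a => ⌊(m i r : ℝ) * p r a⌋₊
  let R : ι → ℕ := fun i => ∑ r ∈ s, ∑ a ∈ range (r / 2 + 1),
    (if r = r₀ ∧ a = 1 then 0 else 2 * a * x i r a)
  let y : ι → ℕ → ℕ → ℕ := fun i r a => if r = r₀ ∧ a = 1 then (W i - R i) / 2 else x i r a
  let t : ι → ℕ → ℕ → ℕ := fun i r a =>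
    if a = 0 then m i r - ∑ b ∈ range (r / 2), y i r (b + 1) else y i r a
  have hx : ∀ r ∈ s, ∀ a ∈ range (r / 2 + 1),
      Tendsto (fun i => (x i r a : ℝ) / N i) F (𝓝 (μ r * p r a)) := by
    intro r hr a ha
    refine tendsto_floor_div hN (fun i => mul_nonneg (Nat.cast_nonneg _) (hp r a ha).le) ?_
    refine ((hm r hr).mul_const (p r a)).congr fun i => ?_
    ring
  have hR : Tendsto (fun i => (R i : ℝ) / N i) F (𝓝 (∑ r ∈ s, ∑ a ∈ range (r / 2 + 1),
      if r = r₀ ∧ a = 1 then 0 else ((2 * a : ℕ) : ℝ) * (μ r * p r a))) := by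
    have : Tendsto (fun i => ∑ r ∈ s, ∑ a ∈ range (r / 2 + 1),
        if r = r₀ ∧ a = 1 then 0 else ((2 * a : ℕ) : ℝ) * ((x i r a : ℝ) / N i)) F
        (𝓝 (∑ r ∈ s, ∑ a ∈ range (r / 2 + 1),
          if r = r₀ ∧ a = 1 then 0 else ((2 * a : ℕ) : ℝ) * (μ r * p r a))) := by
      refine tendsto_finsetSum _ fun r hr => tendsto_finsetSum _ fun a ha => ?_
      split_ifs
      · exact tendsto_const_nhds
      · exact (hx r hr a ha).const_mul _
    refine this.congr fun i => ?_
    simp only [R, Nat.cast_sum, sum_div]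
    refine sum_congr rfl fun r _ => sum_congr rfl fun a _ => ?_
    split_ifs
    · simp
    · push_cast; ring
  have hlim : (∑ r ∈ s, ∑ a ∈ range (r / 2 + 1),
      if r = r₀ ∧ a = 1 then 0 else ((2 * a : ℕ) : ℝ) * (μ r * p r a)) + 2 * (μ r₀ * p r₀ 1) = ω := by
    have := sum_sum_ite_add s (fun r => range (r / 2 + 1)) hr₀ h1mem
      fun r a => ((2 * a : ℕ) : ℝ) * (μ r * p r a)
    rw [← hω]
    rw [mul_one, Nat.cast_ofNat] at this
    rw [this]
    refine sum_congr rfl fun r _ => ?_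
    rw [mul_sum]
    exact sum_congr rfl fun a _ => by ring
  have hpos1 : 0 < μ r₀ * p r₀ 1 := mul_pos (hμ r₀ hr₀) (hp r₀ 1 h1mem)
  have hWR : Tendsto (fun i => ((W i : ℝ) - R i) / N i) F (𝓝 (2 * (μ r₀ * p r₀ 1))) := by
    have := hW.sub hR
    rw [← hlim, add_sub_cancel_left] at this
    exact this.congr fun i => by rw [sub_div]
  -- The repaired entries have positive limits, so the natural subtractions are eventually not
  -- truncated.
  have hRW : ∀ᶠ i in F, R i ≤ W i := by
    filter_upwards [hWR.eventually_const_lt (by linarith : (0 : ℝ) < 2 * (μ r₀ * p r₀ 1))] with i hi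
    by_contra hlt
    have : (W i : ℝ) - R i ≤ 0 := by
      rw [sub_nonpos]; exact_mod_cast (not_le.1 hlt).le
    exact absurd hi (not_lt.2 (div_nonpos_of_nonpos_of_nonneg this (Nat.cast_nonneg _)))
  have hReven : ∀ i, Even (R i) := fun i =>
    even_sum _ fun r _ => even_sum _ fun a _ => by
      split_ifs
      · exact Even.zero
      · exact (even_two_mul a).mul_right _
  have hhalf : ∀ i, R i ≤ W i → 2 * ((W i - R i) / 2) = W i - R i := fun i hi =>
    Nat.two_mul_div_two_of_even ((Nat.even_sub hi).2 (iff_of_true (heven i) (hReven i)))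
  have hy : ∀ r ∈ s, ∀ a ∈ range (r / 2 + 1),
      Tendsto (fun i => (y i r a : ℝ) / N i) F (𝓝 (μ r * p r a)) := by
    intro r hr a ha
    by_cases h : r = r₀ ∧ a = 1
    · obtain ⟨rfl, rfl⟩ := h
      have := hWR.div_const 2
      rw [mul_div_cancel_left₀ _ two_ne_zero] at this
      refine this.congr' ?_
      filter_upwards [hRW] with i hi
      simp only [y, and_self, if_true]
      have h3 : (2 : ℝ) * ((W i - R i) / 2 : ℕ) = W i - R i := by
        rw [← Nat.cast_sub hi]
        exact_mod_cast hhalf i hi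
      rw [← h3]
      ring
    · simp only [y, if_neg h]
      exact hx r hr a ha
  have hsplit : ∀ (r : ℕ) (f : ℕ → ℝ), ∑ a ∈ range (r / 2 + 1), f a =
      ∑ b ∈ range (r / 2), f (b + 1) + f 0 := fun r f => sum_range_succ' f _
  have hz : ∀ r ∈ s, Tendsto (fun i => ((m i r : ℝ) - (∑ b ∈ range (r / 2), y i r (b + 1) : ℕ)) / N i)
      F (𝓝 (μ r * p r 0)) := by
    intro r hr
    have h3 := (hm r hr).sub (tendsto_finsetSum (range (r / 2)) fun b hb =>
      hy r hr (b + 1) (by simp only [mem_range] at hb ⊢; omega))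
    have h4 : μ r - ∑ b ∈ range (r / 2), μ r * p r (b + 1) = μ r * p r 0 := by
      have := hsum r
      rw [hsplit] at this
      rw [← mul_sum, eq_sub_of_add_eq this]
      ring
    rw [h4] at h3
    refine h3.congr fun i => ?_
    rw [sub_div, Nat.cast_sum, sum_div]
  have hle : ∀ r ∈ s, ∀ᶠ i in F, ∑ b ∈ range (r / 2), y i r (b + 1) ≤ m i r := by
    intro r hr
    filter_upwards [(hz r hr).eventually_const_lt (mul_pos (hμ r hr) (hp r 0 (by simp)))] with i hi
    by_contra hlt
    have : (m i r : ℝ) - (∑ b ∈ range (r / 2), y i r (b + 1) : ℕ) ≤ 0 := by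
      rw [sub_nonpos]; exact_mod_cast (not_le.1 hlt).le
    exact absurd hi (not_lt.2 (div_nonpos_of_nonpos_of_nonneg this (Nat.cast_nonneg _)))
  refine ⟨t, ?_, ?_⟩
  · intro r hr a ha
    by_cases h : a = 0
    · subst h
      refine (hz r hr).congr' ?_
      filter_upwards [hle r hr] with i hi
      simp only [t, if_true]
      rw [Nat.cast_sub hi]
    · simp only [t, if_neg h]
      exact hy r hr a ha
  · filter_upwards [hRW, (eventually_all_finset s).2 hle] with i hi hi2
    refine ⟨fun r hr => ?_, ?_⟩
    · rw [sum_range_succ']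
      simp only [t, Nat.add_eq_zero_iff, one_ne_zero, and_false, if_false, if_true]
      exact Nat.add_sub_cancel' (hi2 r hr)
    · have h3 : ∀ r a, 2 * a * t i r a = 2 * a * y i r a := by
        intro r a
        by_cases h : a = 0
        · simp [h]
        · simp [t, h]
      simp only [h3]
      rw [← sum_sum_ite_add s (fun r => range (r / 2 + 1)) hr₀ h1mem fun r a => 2 * a * y i r a]
      have h4 : ∑ r ∈ s, ∑ a ∈ range (r / 2 + 1),
          (if r = r₀ ∧ a = 1 then 0 else 2 * a * y i r a) = R i := by
        refine sum_congr rfl fun r _ => sum_congr rfl fun a _ => ?_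
        by_cases h : r = r₀ ∧ a = 1
        · simp [h]
        · simp [h, y]
      rw [h4]
      have h5 : 2 * 1 * y i r₀ 1 = W i - R i := by
        simp only [y, and_self, if_true, mul_one]
        exact hhalf i hi
      rw [h5]
      exact Nat.add_sub_cancel' hi

end Asymptotics

/-! ### Lower bounds for coefficients by single terms of an expansion -/

open Polynomial in
lemma prod_coeff_le_coeff_prod {κ : Type*} (s : Finset κ) (P : κ → ℕ[X]) (e : κ → ℕ) :
    ∏ i ∈ s, (P i).coeff (e i) ≤ (∏ i ∈ s, P i).coeff (∑ i ∈ s, e i) := by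
  classical
  induction s using Finset.induction_on with
  | empty => simp
  | insert a s ha ih =>
    rw [prod_insert ha, prod_insert ha, sum_insert ha, coeff_mul]
    refine (Nat.mul_le_mul_left _ ih).trans ?_
    exact single_le_sum (f := fun x : ℕ × ℕ => (P a).coeff x.1 * (∏ i ∈ s, P i).coeff x.2)
      (fun _ _ => Nat.zero_le _) (mem_antidiagonal.2 (rfl : (e a, ∑ i ∈ s, e i).1 + _ = _))

open Polynomial in
-- The left side is one term of the multinomial expansion, and no term is negative.
lemma multinomial_mul_le_coeff_evenPoly_pow (r : ℕ) (t : ℕ → ℕ) :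
    Nat.multinomial (range (r / 2 + 1)) t * ∏ a ∈ range (r / 2 + 1), r.choose (2 * a) ^ t a ≤
      (evenPoly r ^ ∑ a ∈ range (r / 2 + 1), t a).coeff (∑ a ∈ range (r / 2 + 1), 2 * a * t a) := by
  classical
  set s := range (r / 2 + 1) with hs
  -- The expansion is indexed by functions that vanish outside `s`.
  let t' : ℕ → ℕ := fun a => if a ∈ s then t a else 0
  have ht' : ∀ a ∈ s, t' a = t a := fun a ha => if_pos ha
  have hmem : t' ∈ s.piAntidiag (∑ a ∈ s, t a) := by
    rw [mem_piAntidiag]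
    refine ⟨sum_congr rfl ht', fun a ha => ?_⟩
    by_contra h
    exact ha (if_neg h)
  have hterm : ∀ k : ℕ → ℕ, (Nat.multinomial s k : ℕ[X]) *
      ∏ a ∈ s, monomial (2 * a) (r.choose (2 * a)) ^ k a =
      monomial (∑ a ∈ s, 2 * a * k a)
        (Nat.multinomial s k * ∏ a ∈ s, r.choose (2 * a) ^ k a) := by
    intro k
    have : ∀ u : Finset ℕ, ∏ a ∈ u, (monomial (2 * a) (r.choose (2 * a)) : ℕ[X]) ^ k a =
        monomial (∑ a ∈ u, 2 * a * k a) (∏ a ∈ u, r.choose (2 * a) ^ k a) := by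
      intro u
      induction u using Finset.induction_on with
      | empty => simp
      | insert a u ha ih =>
        rw [prod_insert ha, prod_insert ha, sum_insert ha, ih, monomial_pow, monomial_mul_monomial]
    rw [this, ← C_eq_natCast, C_mul_monomial]
    simp
  rw [evenPoly, ← hs, sum_pow_eq_sum_piAntidiag, finsetSum_coeff]
  simp only [hterm]
  have h1 : Nat.multinomial s t * ∏ a ∈ s, r.choose (2 * a) ^ t a =
      (monomial (∑ a ∈ s, 2 * a * t' a)
        (Nat.multinomial s t' * ∏ a ∈ s, r.choose (2 * a) ^ t' a)).coeff (∑ a ∈ s, 2 * a * t a) := by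
    rw [sum_congr rfl fun a ha => by rw [ht' a ha], coeff_monomial, if_pos rfl,
      Nat.multinomial_congr ht']
    congr 1
    exact prod_congr rfl fun a ha => by rw [ht' a ha]
  rw [h1]
  exact single_le_sum (f := fun k : ℕ → ℕ => (monomial (∑ a ∈ s, 2 * a * k a)
    (Nat.multinomial s k * ∏ a ∈ s, r.choose (2 * a) ^ k a)).coeff (∑ a ∈ s, 2 * a * t a))
    (fun _ _ => Nat.zero_le _) hmem

end TwoEdgeLDPC

end

/-! ### Bounds for finite ensembles, and passage to the boundary of the region -/

noncomputable section

namespace TwoEdgeLDPC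

open Finset Real Filter Topology

namespace Ensemble

lemma eval_evenPoly_zero (r : ℕ) : (evenPoly r).eval 0 = 1 := by
  rw [evenPoly, Polynomial.eval_finsetSum, sum_range_succ', sum_eq_zero]
  · simp
  · intro a _
    simp

/-- The type of the all-zero word contributes one. -/
lemma expectedCodewords_pos (E : Ensemble) : 0 < E.expectedCodewords := by
  refine lt_of_lt_of_le ?_ (E.typeTerm_le_expectedCodewords 0)
  have h : ∀ j, (E.checkPoly j).coeff 0 = 1 := by
    intro j
    rw [Polynomial.coeff_zero_eq_eval_zero, checkPoly, Polynomial.eval_prod]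
    simp [eval_evenPoly_zero]
  simp [typeTerm, h]

/-- The value at `v > 0` of a polynomial with nonnegative coefficients dominates each of its terms.
-/
lemma coeff_checkPoly_mul_pow_le (E : Ensemble) (j : Fin 2) (w : ℕ) {v : ℝ} (hv : 0 < v) :
    ((E.checkPoly j).coeff w : ℝ) * v ^ w ≤
      ∏ r ∈ (E.checkCount j).support, q r v ^ E.checkCount j r := by
  have h : (E.checkPoly j).eval₂ (Nat.castRingHom ℝ) v =
      ∏ r ∈ (E.checkCount j).support, q r v ^ E.checkCount j r := by
    rw [checkPoly, Polynomial.eval₂_finsetProd]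
    simp only [Polynomial.eval₂_pow, eval_evenPoly]
  rw [← h, Polynomial.eval₂_eq_sum, Polynomial.sum]
  by_cases hw : w ∈ (E.checkPoly j).support
  · exact single_le_sum (f := fun w => (Nat.castRingHom ℝ) ((E.checkPoly j).coeff w) * v ^ w)
      (fun _ _ => mul_nonneg (Nat.cast_nonneg _) (pow_pos hv _).le) hw
  · rw [Polynomial.notMem_support_iff.1 hw, Nat.cast_zero, zero_mul]
    exact sum_nonneg fun _ _ => mul_nonneg (Nat.cast_nonneg _) (pow_pos hv _).le

lemma le_of_coeff_checkPoly_ne_zero (E : Ensemble) (j : Fin 2) {w : ℕ}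
    (h : (E.checkPoly j).coeff w ≠ 0) :
    w ≤ ∑ r ∈ (E.checkCount j).support, E.checkCount j r * (2 * (r / 2)) := by
  refine (Polynomial.le_natDegree_of_ne_zero h).trans ((Polynomial.natDegree_prod_le _ _).trans ?_)
  refine sum_le_sum fun r _ => Polynomial.natDegree_pow_le.trans (Nat.mul_le_mul_left _ ?_)
  refine Polynomial.natDegree_sum_le_of_forall_le _ _ fun a ha => ?_
  refine (Polynomial.natDegree_monomial_le _).trans ?_
  simp only [mem_range] at ha
  omega

end Ensemble

namespace DegreeDist

variable {D : DegreeDist}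

lemma edgeFrac_convex (hV : ∀ j, 0 < D.avgVar j) (σ : (Fin 2 → ℕ) → ℝ) (c t : ℝ) (j : Fin 2) :
    D.edgeFrac (fun l => (1 - t) * σ l + t * c) j = (1 - t) * D.edgeFrac σ j + t * c := by
  have h : c = (∑ l ∈ D.Λ.support, (l j : ℝ) * D.Λ l * c) / D.avgVar j :=
    (edgeFrac_const hV c j).symm
  rw [edgeFrac, edgeFrac]
  conv_rhs => rw [h]
  rw [← mul_div_assoc, ← mul_div_assoc, ← add_div, mul_sum, mul_sum, ← sum_add_distrib]
  congr 1
  exact sum_congr rfl fun l _ => by ring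

/-- Here `σ` may be a boundary point without a saddle point. Mixing it with the constant `c` gives
interior points, to which the bound by `S` applies, and the mixing parameter tends to zero. -/
lemma le_of_forall_le (hV : ∀ j, 0 < D.avgVar j) (hC : ∀ j, 0 < D.avgCheck j)
    (hcap : ∀ j, 0 < D.checkCap j) {S : ℝ}
    (hS : S ∈ upperBounds {t | ∃ e ∈ D.region, D.IsTheta e t})
    {σ : (Fin 2 → ℕ) → ℝ} (hσ : ∀ l, 0 ≤ σ l ∧ σ l ≤ 1)
    (hσcap : ∀ j, D.avgCheck j * D.edgeFrac σ j ≤ D.checkCap j) {x : ℝ}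
    (hx : ∀ v : Fin 2 → ℝ, (∀ j, 0 < v j) → x ≤ ∑ l ∈ D.Λ.support, D.Λ l * binEntropy (σ l) +
      ∑ j, D.checkPart j (D.edgeFrac σ j) (v j) -
      ∑ j, D.avgVar j * binEntropy (D.edgeFrac σ j)) :
    x ≤ (S + D.designRate) * log 2 := by
  obtain ⟨c, hc0, hc1, hc⟩ := exists_const hC hcap
  have hce : ∀ j, D.edgeFrac (fun _ => c) j = c := edgeFrac_const hV c
  obtain ⟨u₀, v₀, h₀⟩ := exists_isSaddlePoint hV hC (σ := fun _ => c) (fun _ => ⟨hc0, hc1⟩)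
    (fun j => by rw [hce]; exact hc j)
  -- A lower bound for `checkPart j c` that is uniform in `v`. This is needed because the saddle
  -- point `v` of the mixture varies with `t`.
  set κ : Fin 2 → ℝ := fun j => D.checkEntropy j fun r => checkTilt r (v₀ j) with hκ
  have hκle : ∀ j v, 0 < v → κ j ≤ D.checkPart j c v := by
    intro j v hv
    have := h₀.checkEntropy_le hV hC j hv
    rwa [hce] at this
  let σt : ℝ → (Fin 2 → ℕ) → ℝ := fun t l => (1 - t) * σ l + t * c
  let V : ℝ → ℝ := fun t => ∑ l ∈ D.Λ.support, D.Λ l * binEntropy (σt t l)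
  let H : ℝ → ℝ := fun t =>
    ∑ j, D.avgVar j * binEntropy ((1 - t) * D.edgeFrac σ j + t * c)
  -- For `0 < t < 1` this is a lower bound for the exponent at the mixture: `checkPart` is affine in
  -- e, and its two parts are bounded by `hx` and by `κ`. It is continuous, with value `x` at `t =
  -- 0`.
  let f : ℝ → ℝ := fun t => V t + (1 - t) * (x - V 0 + H 0) + t * ∑ j, κ j - H t
  have hf : Continuous f := by
    have hb := binEntropy_continuous
    have hVc : Continuous V := continuous_finsetSum _ fun l _ =>
      continuous_const.mul (hb.comp (by fun_prop))
    have hHc : Continuous H := continuous_finsetSum _ fun l _ =>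
      continuous_const.mul (hb.comp (by fun_prop))
    fun_prop
  have hf0 : f 0 = x := by simp only [f]; ring
  have hlim : Tendsto f (𝓝[>] 0) (𝓝 x) := by
    rw [← hf0]
    exact (hf.tendsto 0).mono_left nhdsWithin_le_nhds
  refine le_of_tendsto hlim ?_
  filter_upwards [Ioo_mem_nhdsGT (zero_lt_one (α := ℝ))] with t ht
  obtain ⟨ht0, ht1⟩ := ht
  have h1t : 0 < 1 - t := by linarith
  have hσt : ∀ l, 0 < σt t l ∧ σt t l < 1 := by
    intro l
    have := mul_nonneg h1t.le (hσ l).1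
    have := mul_le_mul_of_nonneg_left (hσ l).2 h1t.le
    have := mul_pos ht0 hc0
    have := mul_lt_mul_of_pos_left hc1 ht0
    simp only [σt]
    constructor <;> linarith
  have he : ∀ j, D.edgeFrac (σt t) j = (1 - t) * D.edgeFrac σ j + t * c :=
    edgeFrac_convex hV σ c t
  obtain ⟨u, v, h⟩ := exists_isSaddlePoint hV hC hσt fun j => by
    rw [he]
    have := mul_le_mul_of_nonneg_left (hσcap j) h1t.le
    have := mul_lt_mul_of_pos_left (hc j) ht0
    linarith
  have hθ : D.thetaExpr (D.edgeFrac (σt t)) u v ≤ S :=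
    hS ⟨_, edgeFrac_mem_region fun l => ⟨(hσt l).1.le, (hσt l).2.le⟩, u, v, h, rfl⟩
  have h2 : (D.thetaExpr (D.edgeFrac (σt t)) u v + D.designRate) * log 2 ≤
      (S + D.designRate) * log 2 :=
    mul_le_mul_of_nonneg_right (by linarith) (log_pos one_lt_two).le
  refine le_trans ?_ h2
  rw [thetaExpr_add_designRate]
  have hvar : V t ≤ D.varPart (D.edgeFrac (σt t)) u :=
    sum_binEntropy_le_varPart hV (fun l => ⟨(hσt l).1.le, (hσt l).2.le⟩) h.u_pos
  have hH : ∑ j, D.avgVar j * binEntropy (D.edgeFrac (σt t) j) = H t := by simp only [he, H]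
  have hcheck : ∀ j, D.checkPart j (D.edgeFrac (σt t) j) (v j) =
      (1 - t) * D.checkPart j (D.edgeFrac σ j) (v j) + t * D.checkPart j c (v j) := by
    intro j
    rw [he, checkPart, checkPart, checkPart]
    ring
  have hxv := hx v h.v_pos
  have hV0 : V 0 = ∑ l ∈ D.Λ.support, D.Λ l * binEntropy (σ l) := by simp [V, σt]
  have hH0 : H 0 = ∑ j, D.avgVar j * binEntropy (D.edgeFrac σ j) := by simp [H]
  have h3 : (1 - t) * (x - V 0 + H 0) ≤
      (1 - t) * ∑ j, D.checkPart j (D.edgeFrac σ j) (v j) :=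
    mul_le_mul_of_nonneg_left (by rw [hV0, hH0]; linarith) h1t.le
  have h4 : t * ∑ j, κ j ≤ t * ∑ j, D.checkPart j c (v j) :=
    mul_le_mul_of_nonneg_left (sum_le_sum fun j _ => hκle j _ (h.v_pos j)) ht0.le
  rw [hH, sum_congr rfl fun j _ => hcheck j, sum_add_distrib, ← mul_sum, ← mul_sum]
  simp only [f]
  linarith

end DegreeDist

/-! ### Limits of node and edge counts along a sequence of ensembles -/

namespace HasDegreeDist

variable {E : ℕ → Ensemble} {D : DegreeDist}

lemma tendsto_blockLength (h : HasDegreeDist E D) :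
    Tendsto (fun i => ((E i).blockLength : ℝ)) atTop atTop :=
  tendsto_natCast_atTop_atTop.comp h.blockLength_tendsto

/-- Replaces the support, which varies with `i`, by the fixed support of the limit, so that limits
can be taken termwise. -/
lemma prod_varCount {M : Type*} [CommMonoid M] (h : HasDegreeDist E D) (i : ℕ)
    (f : (Fin 2 → ℕ) → M) (hf : ∀ l, (E i).varCount l = 0 → f l = 1) :
    ∏ l ∈ (E i).varCount.support, f l = ∏ l ∈ D.Λ.support, f l := by
  refine prod_subset (fun l hl => ?_) fun l _ hl => hf l (Finsupp.notMem_support_iff.1 hl)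
  rw [Finsupp.mem_support_iff] at hl ⊢
  exact fun h0 => hl (h.varCount_eq_zero i l h0)

lemma sum_varCount {M : Type*} [AddCommMonoid M] (h : HasDegreeDist E D) (i : ℕ)
    (f : (Fin 2 → ℕ) → M) (hf : ∀ l, (E i).varCount l = 0 → f l = 0) :
    ∑ l ∈ (E i).varCount.support, f l = ∑ l ∈ D.Λ.support, f l :=
  h.prod_varCount (M := Multiplicative M) i f hf

lemma prod_checkCount {M : Type*} [CommMonoid M] (h : HasDegreeDist E D) (i : ℕ) (j : Fin 2)
    (f : ℕ → M) (hf : ∀ r, (E i).checkCount j r = 0 → f r = 1) :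
    ∏ r ∈ ((E i).checkCount j).support, f r = ∏ r ∈ (D.Γ j).support, f r := by
  refine prod_subset (fun l hl => ?_) fun l _ hl => hf l (Finsupp.notMem_support_iff.1 hl)
  rw [Finsupp.mem_support_iff] at hl ⊢
  exact fun h0 => hl (h.checkCount_eq_zero i j l h0)

lemma sum_checkCount {M : Type*} [AddCommMonoid M] (h : HasDegreeDist E D) (i : ℕ) (j : Fin 2)
    (f : ℕ → M) (hf : ∀ r, (E i).checkCount j r = 0 → f r = 0) :
    ∑ r ∈ ((E i).checkCount j).support, f r = ∑ r ∈ (D.Γ j).support, f r :=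
  h.prod_checkCount (M := Multiplicative M) i j f hf

lemma tendsto_numEdges (h : HasDegreeDist E D) (j : Fin 2) :
    Tendsto (fun i => ((E i).numEdges j : ℝ) / (E i).blockLength) atTop (𝓝 (D.avgVar j)) := by
  have := tendsto_finsetSum D.Λ.support fun l _ => (h.var_tendsto l).const_mul (l j : ℝ)
  refine this.congr fun i => ?_
  rw [Ensemble.numEdges, h.sum_varCount i (fun l => l j * (E i).varCount l) (by simp +contextual),
    Nat.cast_sum, sum_div]
  exact sum_congr rfl fun l _ => by push_cast; ring

lemma numEdges_eq_sum_checkCount (h : HasDegreeDist E D) (i : ℕ) (j : Fin 2) :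
    (E i).numEdges j = ∑ r ∈ (D.Γ j).support, r * (E i).checkCount j r := by
  rw [Ensemble.numEdges, (E i).edges_match,
    h.sum_checkCount i j (fun r => r * (E i).checkCount j r) (by simp +contextual)]

/-- Checks per variable node are edges per variable node divided by edges per check node. -/
lemma tendsto_numChecks (h : HasDegreeDist E D) (hV : ∀ j, 0 < D.avgVar j)
    (hC : ∀ j, 0 < D.avgCheck j) (j : Fin 2) :
    Tendsto (fun i => ((E i).numChecks j : ℝ) / (E i).blockLength) atTop
      (𝓝 (D.avgVar j / D.avgCheck j)) := by
  have h1 : Tendsto (fun i => ((E i).numEdges j : ℝ) / (E i).numChecks j) atTop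
      (𝓝 (D.avgCheck j)) := by
    have := tendsto_finsetSum (D.Γ j).support fun r _ => (h.check_tendsto j r).const_mul (r : ℝ)
    refine this.congr fun i => ?_
    rw [h.numEdges_eq_sum_checkCount, Nat.cast_sum, sum_div]
    exact sum_congr rfl fun r _ => by push_cast; ring
  refine ((h.tendsto_numEdges j).div h1 (hC j).ne').congr' ?_
  filter_upwards [(h.tendsto_numEdges j).eventually_const_lt (hV j)] with i hi
  have : ((E i).numEdges j : ℝ) ≠ 0 := by
    intro h0; rw [h0, zero_div] at hi; exact lt_irrefl _ hi
  simp only [Pi.div_apply]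
  rw [div_div_div_comm, div_self this, one_div_div]

lemma tendsto_checkCount (h : HasDegreeDist E D) (hV : ∀ j, 0 < D.avgVar j)
    (hC : ∀ j, 0 < D.avgCheck j) (j : Fin 2) (r : ℕ) :
    Tendsto (fun i => ((E i).checkCount j r : ℝ) / (E i).blockLength) atTop
      (𝓝 (D.avgVar j / D.avgCheck j * D.Γ j r)) := by
  have h1 := (h.tendsto_numChecks hV hC j).mul (h.check_tendsto j r)
  refine h1.congr fun i => ?_
  by_cases h0 : (E i).numChecks j = 0
  · have : (E i).checkCount j r = 0 := by
      by_contra hr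
      exact hr (sum_eq_zero_iff.1 h0 r (Finsupp.mem_support_iff.2 hr))
    simp [this]
  · have : ((E i).numChecks j : ℝ) ≠ 0 := by exact_mod_cast h0
    field_simp

/-! ### Exponents of type terms, and the two bounds for the growth rate -/

section Types

variable {F : Filter ℕ} {k : ℕ → (Fin 2 → ℕ) → ℕ} {σ : (Fin 2 → ℕ) → ℝ}

/-- The number of edges of type `j` at variable nodes of value one, for words of type `k`. -/
abbrev typeWeight (D : DegreeDist) (k : (Fin 2 → ℕ) → ℕ) (j : Fin 2) : ℕ :=
  ∑ l ∈ D.Λ.support, l j * k l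

lemma typeTerm_eq (h : HasDegreeDist E D) (i : ℕ) {k : (Fin 2 → ℕ) → ℕ}
    (hk : ∀ l, k l ≤ (E i).varCount l) :
    (E i).typeTerm k = (∏ l ∈ D.Λ.support, (((E i).varCount l).choose (k l) : ℝ)) *
      ∏ j, (((E i).checkPoly j).coeff (typeWeight D k j) : ℝ) /
        ((E i).numEdges j).choose (typeWeight D k j) := by
  have h0 : ∀ l, (E i).varCount l = 0 → k l = 0 := fun l hl => Nat.le_zero.1 (hl ▸ hk l)
  have h1 : ∀ j : Fin 2, ∑ l ∈ (E i).varCount.support, l j * k l = typeWeight D k j := fun j =>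
    h.sum_varCount i (fun l => l j * k l) fun l hl => by simp [h0 l hl]
  rw [Ensemble.typeTerm, h.prod_varCount i (fun l => (((E i).varCount l).choose (k l) : ℝ))
    fun l hl => by simp [h0 l hl]]
  simp only [h1]

lemma typeWeight_le (h : HasDegreeDist E D) (i : ℕ) {k : (Fin 2 → ℕ) → ℕ}
    (hk : ∀ l, k l ≤ (E i).varCount l) (j : Fin 2) :
    typeWeight D k j ≤ (E i).numEdges j := by
  rw [Ensemble.numEdges, h.sum_varCount i (fun l => l j * (E i).varCount l) (by simp +contextual)]
  exact sum_le_sum fun l _ => Nat.mul_le_mul_left _ (hk l)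

lemma tendsto_typeWeight (hV : ∀ j, 0 < D.avgVar j)
    (hkσ : ∀ l, Tendsto (fun i => (k i l : ℝ) / (E i).blockLength) F (𝓝 (D.Λ l * σ l)))
    (j : Fin 2) :
    Tendsto (fun i => (typeWeight D (k i) j : ℝ) / (E i).blockLength) F
      (𝓝 (D.avgVar j * D.edgeFrac σ j)) := by
  have := tendsto_finsetSum D.Λ.support fun l _ => (hkσ l).const_mul (l j : ℝ)
  have h2 : D.avgVar j * D.edgeFrac σ j = ∑ l ∈ D.Λ.support, (l j : ℝ) * (D.Λ l * σ l) := by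
    rw [DegreeDist.edgeFrac, mul_div_cancel₀ _ (hV j).ne']
    exact sum_congr rfl fun l _ => by ring
  rw [h2]
  refine this.congr fun i => ?_
  rw [Nat.cast_sum, sum_div]
  exact sum_congr rfl fun l _ => by push_cast; ring

/-- The contribution of all binomial coefficients to the exponent of `typeTerm`. -/
lemma tendsto_log_chooses (h : HasDegreeDist E D) (hV : ∀ j, 0 < D.avgVar j) (hF : F ≤ atTop)
    (hk : ∀ i l, k i l ≤ (E i).varCount l)
    (hkσ : ∀ l, Tendsto (fun i => (k i l : ℝ) / (E i).blockLength) F (𝓝 (D.Λ l * σ l))) :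
    Tendsto (fun i => ∑ l ∈ D.Λ.support,
        log (((E i).varCount l).choose (k i l)) / (E i).blockLength -
        ∑ j, log (((E i).numEdges j).choose (typeWeight D (k i) j)) / (E i).blockLength) F
      (𝓝 (∑ l ∈ D.Λ.support, D.Λ l * binEntropy (σ l) -
        ∑ j, D.avgVar j * binEntropy (D.edgeFrac σ j))) := by
  have hN := h.tendsto_blockLength.mono_left hF
  refine (tendsto_finsetSum _ fun l _ => ?_).sub (tendsto_finsetSum _ fun j _ => ?_)
  · exact tendsto_log_choose hN ((h.var_tendsto l).mono_left hF) (hkσ l) fun i => hk i l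
  · exact tendsto_log_choose hN ((h.tendsto_numEdges j).mono_left hF)
      (tendsto_typeWeight hV hkσ j) fun i => h.typeWeight_le i (hk i) j

lemma log_typeTerm (h : HasDegreeDist E D) (i : ℕ) {k : (Fin 2 → ℕ) → ℕ}
    (hk : ∀ l, k l ≤ (E i).varCount l)
    (hpos : ∀ j, 0 < ((E i).checkPoly j).coeff (typeWeight D k j)) :
    log ((E i).typeTerm k) / (E i).blockLength =
      ∑ l ∈ D.Λ.support, log (((E i).varCount l).choose (k l)) / (E i).blockLength -
        ∑ j, log (((E i).numEdges j).choose (typeWeight D k j)) / (E i).blockLength +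
      ∑ j, log (((E i).checkPoly j).coeff (typeWeight D k j)) / (E i).blockLength := by
  have h1 : ∀ l, (((E i).varCount l).choose (k l) : ℝ) ≠ 0 := fun l => by
    exact_mod_cast (Nat.choose_pos (hk l)).ne'
  have h2 : ∀ j, (((E i).numEdges j).choose (typeWeight D k j) : ℝ) ≠ 0 := fun j => by
    exact_mod_cast (Nat.choose_pos (h.typeWeight_le i hk j)).ne'
  have h3 : ∀ j, (((E i).checkPoly j).coeff (typeWeight D k j) : ℝ) ≠ 0 := fun j => by
    exact_mod_cast (hpos j).ne'
  rw [h.typeTerm_eq i hk, log_mul (prod_ne_zero_iff.2 fun l _ => h1 l)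
    (prod_ne_zero_iff.2 fun j _ => div_ne_zero (h3 j) (h2 j)), log_prod fun l _ => h1 l,
    log_prod fun j _ => div_ne_zero (h3 j) (h2 j), sum_congr rfl fun j _ => log_div (h3 j) (h2 j),
    sum_sub_distrib]
  simp only [← sum_div]
  ring

/-- A lower bound for the exponent of the number of check side words. -/
lemma exists_le_log_coeff (h : HasDegreeDist E D) (hV : ∀ j, 0 < D.avgVar j)
    (hC : ∀ j, 0 < D.avgCheck j) (hcheck : ∀ j, ∃ r, 2 ≤ r ∧ 0 < D.Γ j r)
    {e u v : Fin 2 → ℝ} (hs : D.IsSaddlePoint e u v) (j : Fin 2) {W : ℕ → ℕ}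
    (hW : Tendsto (fun i => (W i : ℝ) / (E i).blockLength) atTop (𝓝 (D.avgVar j * e j)))
    (heven : ∀ i, Even (W i)) :
    ∃ f : ℕ → ℝ, Tendsto f atTop
        (𝓝 (D.checkEntropy j fun r => DegreeDist.checkTilt r (v j))) ∧
      ∀ᶠ i in atTop, 0 < ((E i).checkPoly j).coeff (W i) ∧
        f i ≤ log (((E i).checkPoly j).coeff (W i)) / (E i).blockLength := by
  have hN := h.tendsto_blockLength
  obtain ⟨r₀, hr₀, hΓ⟩ := hcheck j
  set μ : ℕ → ℝ := fun r => D.avgVar j / D.avgCheck j * D.Γ j r with hμ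
  set p : ℕ → ℕ → ℝ := fun r => DegreeDist.checkTilt r (v j) with hp
  have hω : ∑ r ∈ (D.Γ j).support, μ r * ∑ a ∈ range (r / 2 + 1), ((2 * a : ℕ) : ℝ) * p r a =
      D.avgVar j * e j := by
    simp only [hμ, mul_assoc]
    rw [← mul_sum, hs.sum_checkTilt_eq hC j]
    have := (hC j).ne'
    field_simp
  obtain ⟨t, ht, hev⟩ := exists_approx_type hN (D.Γ j).support
    (m := fun i r => (E i).checkCount j r) (μ := μ) (p := p)
    (fun r _ => h.tendsto_checkCount hV hC j r)
    (fun r hr => mul_pos (div_pos (hV j) (hC j)) (DegreeDist.Γ_pos hr))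
    (fun r a ha => DegreeDist.checkTilt_pos (hs.v_pos j) ha)
    (fun r => DegreeDist.sum_checkTilt r (hs.v_pos j)) hW heven hω
    (Finsupp.mem_support_iff.2 hΓ.ne') hr₀
  -- For each degree only one multinomial term, the one of type `t i r`, is kept. Its exponent tends
  -- to the entropy of the tilt.
  refine ⟨fun i => ∑ r ∈ (D.Γ j).support,
    (log (Nat.multinomial (range (r / 2 + 1)) (t i r)) / (E i).blockLength +
      ∑ a ∈ range (r / 2 + 1), (t i r a : ℝ) / (E i).blockLength * log (r.choose (2 * a))), ?_, ?_⟩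
  · have h1 : D.checkEntropy j p = ∑ r ∈ (D.Γ j).support,
        (μ r * ∑ a ∈ range (r / 2 + 1), negMulLog (p r a) +
          ∑ a ∈ range (r / 2 + 1), μ r * p r a * log (r.choose (2 * a))) := by
      rw [DegreeDist.checkEntropy, mul_sum]
      refine sum_congr rfl fun r _ => ?_
      rw [sum_add_distrib, hμ, mul_add, mul_add, mul_sum, mul_sum, mul_sum, mul_sum, mul_sum]
      congr 1 <;> exact sum_congr rfl fun a _ => by ring
    rw [h1]
    refine tendsto_finsetSum _ fun r hr => Tendsto.add ?_ (tendsto_finsetSum _ fun a ha => ?_)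
    · exact tendsto_log_multinomial hN _ (DegreeDist.sum_checkTilt r (hs.v_pos j)) (ht r hr)
    · exact (ht r hr a ha).mul_const _
  · filter_upwards [hev] with i hi
    have h1 : ∏ r ∈ (D.Γ j).support, (Nat.multinomial (range (r / 2 + 1)) (t i r) *
        ∏ a ∈ range (r / 2 + 1), r.choose (2 * a) ^ t i r a) ≤
        ((E i).checkPoly j).coeff (W i) := by
      rw [Ensemble.checkPoly, h.prod_checkCount i j
        (fun r => evenPoly r ^ (E i).checkCount j r) (fun r hr => by rw [hr, pow_zero]), ← hi.2]
      refine le_trans (prod_le_prod' fun r hr => ?_) (prod_coeff_le_coeff_prod _ _ _)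
      rw [← hi.1 r hr]
      exact multinomial_mul_le_coeff_evenPoly_pow r (t i r)
    have hch : ∀ r, ∀ a ∈ range (r / 2 + 1), 0 < r.choose (2 * a) := fun r a ha =>
      Nat.choose_pos (by simp only [mem_range] at ha; omega)
    have h2 : ∀ r, 0 < ∏ a ∈ range (r / 2 + 1), r.choose (2 * a) ^ t i r a := fun r =>
      prod_pos fun a ha => pow_pos (hch r a ha) _
    have h3 : 0 < ∏ r ∈ (D.Γ j).support, (Nat.multinomial (range (r / 2 + 1)) (t i r) *
        ∏ a ∈ range (r / 2 + 1), r.choose (2 * a) ^ t i r a) :=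
      prod_pos fun r _ => mul_pos (Nat.multinomial_pos _ _) (h2 r)
    refine ⟨h3.trans_le h1, ?_⟩
    have h4 := log_le_log (by exact_mod_cast h3) (by exact_mod_cast h1 :
      ((∏ r ∈ (D.Γ j).support, (Nat.multinomial (range (r / 2 + 1)) (t i r) *
        ∏ a ∈ range (r / 2 + 1), r.choose (2 * a) ^ t i r a) : ℕ) : ℝ) ≤
        (((E i).checkPoly j).coeff (W i) : ℝ))
    refine le_trans (le_of_eq ?_) (div_le_div_of_nonneg_right h4 (Nat.cast_nonneg _))
    rw [Nat.cast_prod, log_prod fun r _ => by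
      exact_mod_cast (mul_pos (Nat.multinomial_pos _ _) (h2 r)).ne', sum_div]
    refine sum_congr rfl fun r _ => ?_
    rw [Nat.cast_mul, log_mul (by exact_mod_cast (Nat.multinomial_pos _ _).ne')
      (by exact_mod_cast (h2 r).ne'), Nat.cast_prod, log_prod fun a ha => by
        exact_mod_cast (pow_pos (hch r a ha) _).ne', add_div, sum_div]
    congr 1
    refine sum_congr rfl fun a _ => ?_
    rw [Nat.cast_pow, log_pow]
    ring

/-- The lower bound for the growth rate. -/
lemma exists_le_log_expectedCodewords (h : HasDegreeDist E D) (hV : ∀ j, 0 < D.avgVar j)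
    (hC : ∀ j, 0 < D.avgCheck j) (hcheck : ∀ j, ∃ r, 2 ≤ r ∧ 0 < D.Γ j r)
    {e u v : Fin 2 → ℝ} (hs : D.IsSaddlePoint e u v) :
    ∃ f : ℕ → ℝ, Tendsto f atTop (𝓝 ((D.thetaExpr e u v + D.designRate) * log 2)) ∧
      ∀ᶠ i in atTop, f i ≤ log (E i).expectedCodewords / (E i).blockLength := by
  have hN := h.tendsto_blockLength
  set σ := DegreeDist.tilt u with hσdef
  have hσ := DegreeDist.tilt_mem hs.u_pos
  -- Even entries make both edge weights even. At an odd weight the coefficient of `checkPoly` would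
  -- vanish.
  let k : ℕ → (Fin 2 → ℕ) → ℕ := fun i l => 2 * ⌊((E i).varCount l : ℝ) * σ l / 2⌋₊
  have hk : ∀ i l, k i l ≤ (E i).varCount l := by
    intro i l
    have h0 : 0 ≤ ((E i).varCount l : ℝ) * σ l / 2 := by
      have := (hσ l).1; positivity
    have h1 := Nat.floor_le h0
    have h2 := mul_le_of_le_one_right (Nat.cast_nonneg (α := ℝ) ((E i).varCount l)) (hσ l).2
    have : ((k i l : ℕ) : ℝ) ≤ (E i).varCount l := by
      simp only [k]; push_cast; linarith
    exact_mod_cast this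
  have hkσ : ∀ l, Tendsto (fun i => (k i l : ℝ) / (E i).blockLength) atTop (𝓝 (D.Λ l * σ l)) := by
    intro l
    have h1 : Tendsto (fun i => ((E i).varCount l : ℝ) * σ l / 2 / (E i).blockLength) atTop
        (𝓝 (D.Λ l * σ l / 2)) := by
      refine (((h.var_tendsto l).mul_const (σ l)).div_const 2).congr fun i => ?_
      ring
    have h2 := (tendsto_floor_div hN (fun i => by have := (hσ l).1; positivity) h1).const_mul 2
    rw [mul_div_cancel₀ _ two_ne_zero] at h2
    refine h2.congr fun i => ?_
    simp only [k]
    push_cast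
    ring
  have hW : ∀ j, Tendsto (fun i => (typeWeight D (k i) j : ℝ) / (E i).blockLength) atTop
      (𝓝 (D.avgVar j * e j)) := fun j => by
    have := tendsto_typeWeight hV hkσ j
    rwa [hσdef, ← hs.eq_edgeFrac] at this
  have heven : ∀ j i, Even (typeWeight D (k i) j) := fun j i =>
    even_sum _ fun l _ => (even_two_mul _).mul_left _
  choose f hf hfle using fun j => h.exists_le_log_coeff hV hC hcheck hs j (hW j) (heven j)
  refine ⟨fun i => (∑ l ∈ D.Λ.support,
        log (((E i).varCount l).choose (k i l)) / (E i).blockLength -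
        ∑ j, log (((E i).numEdges j).choose (typeWeight D (k i) j)) / (E i).blockLength) +
        ∑ j, f j i, ?_, ?_⟩
  · have h1 := (h.tendsto_log_chooses hV le_rfl hk hkσ).add
      (tendsto_finsetSum univ fun j _ => hf j)
    have h2 : (D.thetaExpr e u v + D.designRate) * log 2 =
        ∑ l ∈ D.Λ.support, D.Λ l * binEntropy (σ l) -
          ∑ j, D.avgVar j * binEntropy (D.edgeFrac σ j) +
          ∑ j, D.checkEntropy j fun r => DegreeDist.checkTilt r (v j) := by
      rw [DegreeDist.thetaExpr_add_designRate,
        sum_congr rfl fun j _ => hs.checkPart_eq_checkEntropy hC j, hσdef, ← hs.eq_edgeFrac,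
        ← DegreeDist.varPart_tilt hV hs.u_pos, ← hs.eq_edgeFrac]
      ring
    rw [h2]
    exact h1
  · filter_upwards [eventually_all.2 hfle] with i hi
    have h1 := h.log_typeTerm i (hk i) fun j => (hi j).1
    have hpos : 0 < (E i).typeTerm (k i) := by
      rw [h.typeTerm_eq i (hk i)]
      refine mul_pos (prod_pos fun l _ => ?_) (prod_pos fun j _ => div_pos ?_ ?_)
      · exact_mod_cast Nat.choose_pos (hk i l)
      · exact_mod_cast (hi j).1
      · exact_mod_cast Nat.choose_pos (h.typeWeight_le i (hk i) j)
    have h2 := div_le_div_of_nonneg_right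
      (log_le_log hpos ((E i).typeTerm_le_expectedCodewords (k i)))
      (Nat.cast_nonneg (α := ℝ) (E i).blockLength)
    rw [h1] at h2
    refine le_trans ?_ h2
    gcongr with j
    exact (hi j).2

/-- The upper bound for the growth rate. -/
lemma eventually_log_expectedCodewords_lt (h : HasDegreeDist E D) (hV : ∀ j, 0 < D.avgVar j)
    (hC : ∀ j, 0 < D.avgCheck j) (hcap : ∀ j, 0 < D.checkCap j) {S : ℝ}
    (hS : S ∈ upperBounds {t | ∃ e ∈ D.region, D.IsTheta e t}) {x : ℝ}
    (hx : (S + D.designRate) * log 2 < x) :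
    ∀ᶠ i in atTop, log (E i).expectedCodewords / (E i).blockLength < x := by
  by_contra hcon
  rw [not_eventually] at hcon
  have hne : NeBot (atTop ⊓ 𝓟 {i | ¬ log (E i).expectedCodewords / (E i).blockLength < x}) :=
    frequently_mem_iff_neBot.1 hcon
  -- An ultrafilter on the bad indices plays the role of a subsequence along which all type
  -- fractions converge.
  set F : Ultrafilter ℕ := Ultrafilter.of
    (atTop ⊓ 𝓟 {i | ¬ log (E i).expectedCodewords / (E i).blockLength < x})
  have hFle : (F : Filter ℕ) ≤ _ := Ultrafilter.of_le _
  have hF : (F : Filter ℕ) ≤ atTop := hFle.trans inf_le_left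
  have hbad : ∀ᶠ i in (F : Filter ℕ), x ≤ log (E i).expectedCodewords / (E i).blockLength := by
    have : ∀ᶠ i in (F : Filter ℕ), ¬ log (E i).expectedCodewords / (E i).blockLength < x :=
      (hFle.trans inf_le_right) (mem_principal_self _)
    exact this.mono fun i hi => not_lt.1 hi
  have hN := h.tendsto_blockLength.mono_left hF
  choose k hk hkle using fun i => (E i).exists_expectedCodewords_le
  -- Fractions within each degree class lie in `[0, 1]`, so Tychonoff's theorem applies. An empty
  -- class gets the value zero.
  let ρ : ℕ → (Fin 2 → ℕ) → ℝ := fun i l => (k i l : ℝ) / (E i).varCount l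
  have hρ : ∀ i, ρ i ∈ Set.univ.pi fun _ : Fin 2 → ℕ => Set.Icc (0 : ℝ) 1 := fun i l _ =>
    ⟨by positivity, div_le_one_of_le₀ (by exact_mod_cast hk i l) (Nat.cast_nonneg _)⟩
  obtain ⟨σ, hσmem, hσlim⟩ := (isCompact_univ_pi fun _ : Fin 2 → ℕ =>
    isCompact_Icc (a := (0 : ℝ)) (b := 1)).ultrafilter_le_nhds (F.map ρ) (by
      rw [le_principal_iff]
      exact (Eventually.of_forall hρ : ∀ᶠ i in (F : Filter ℕ), ρ i ∈ _))
  have hσ : ∀ l, 0 ≤ σ l ∧ σ l ≤ 1 := fun l => hσmem l (Set.mem_univ l)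
  have hρlim : ∀ l, Tendsto (fun i => ρ i l) F (𝓝 (σ l)) := fun l =>
    ((continuous_apply l).tendsto σ).comp (show Tendsto ρ F (𝓝 σ) from hσlim)
  have hkσ : ∀ l, Tendsto (fun i => (k i l : ℝ) / (E i).blockLength) F (𝓝 (D.Λ l * σ l)) := by
    intro l
    refine (((h.var_tendsto l).mono_left hF).mul (hρlim l)).congr fun i => ?_
    simp only [ρ]
    by_cases h0 : (E i).varCount l = 0
    · have : k i l = 0 := Nat.le_zero.1 (h0 ▸ hk i l)
      simp [this]
    · have : ((E i).varCount l : ℝ) ≠ 0 := by exact_mod_cast h0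
      field_simp
  have htpos : ∀ i, 0 < (E i).typeTerm (k i) := fun i => by
    have h1 := (E i).expectedCodewords_pos.trans_le (hkle i)
    exact pos_of_mul_pos_right h1 (by positivity)
  have hcoeff : ∀ i j, 0 < ((E i).checkPoly j).coeff (typeWeight D (k i) j) := by
    intro i j
    have h1 := htpos i
    rw [h.typeTerm_eq i (hk i)] at h1
    refine Nat.pos_of_ne_zero fun h0 => ?_
    rw [prod_eq_zero (mem_univ j) (by rw [h0]; simp), mul_zero] at h1
    exact lt_irrefl _ h1
  have hWlim := fun j => tendsto_typeWeight (E := E) (F := F) hV hkσ j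
  have hmlim : ∀ j r, Tendsto (fun i => ((E i).checkCount j r : ℝ) / (E i).blockLength) F
      (𝓝 (D.avgVar j / D.avgCheck j * D.Γ j r)) := fun j r =>
    (h.tendsto_checkCount hV hC j r).mono_left hF
  -- The coefficients are nonzero, so the weight is at most the degree bound of `checkPoly`. The cap
  -- is the limit of that bound.
  have hσcap : ∀ j, D.avgCheck j * D.edgeFrac σ j ≤ D.checkCap j := by
    intro j
    have h1 : Tendsto (fun i => ∑ r ∈ (D.Γ j).support,
        ((E i).checkCount j r : ℝ) / (E i).blockLength * ((2 * (r / 2) : ℕ) : ℝ)) F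
        (𝓝 (∑ r ∈ (D.Γ j).support,
          D.avgVar j / D.avgCheck j * D.Γ j r * ((2 * (r / 2) : ℕ) : ℝ))) :=
      tendsto_finsetSum _ fun r _ => (hmlim j r).mul_const _
    have h2 := le_of_tendsto_of_tendsto' (hWlim j) h1 fun i => by
      have h3 := (E i).le_of_coeff_checkPoly_ne_zero j (hcoeff i j).ne'
      rw [h.sum_checkCount i j (fun r => (E i).checkCount j r * (2 * (r / 2)))
        (by simp +contextual)] at h3
      have h4 : (typeWeight D (k i) j : ℝ) ≤
          ((∑ r ∈ (D.Γ j).support, (E i).checkCount j r * (2 * (r / 2)) : ℕ) : ℝ) := by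
        exact_mod_cast h3
      refine (div_le_div_of_nonneg_right h4 (Nat.cast_nonneg _)).trans (le_of_eq ?_)
      rw [Nat.cast_sum, sum_div]
      exact sum_congr rfl fun r _ => by push_cast; ring
    have h3 : ∑ r ∈ (D.Γ j).support, D.avgVar j / D.avgCheck j * D.Γ j r *
        ((2 * (r / 2) : ℕ) : ℝ) = D.avgVar j / D.avgCheck j * D.checkCap j := by
      rw [DegreeDist.checkCap, mul_sum]
      exact sum_congr rfl fun r _ => by ring
    rw [h3, div_mul_eq_mul_div, mul_div_assoc] at h2
    have h4 := le_of_mul_le_mul_left h2 (hV j)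
    rwa [le_div_iff₀' (hC j)] at h4
  have hpoly : Tendsto (fun i => (#D.Λ.support : ℝ) *
      (log ((E i).blockLength + 1) / (E i).blockLength)) F (𝓝 0) := by
    have h1 : Tendsto (fun i => ((E i).blockLength : ℝ) / (E i).blockLength) F (𝓝 1) := by
      refine tendsto_const_nhds.congr' ?_
      filter_upwards [hN.eventually_gt_atTop 0] with i hi
      rw [div_self hi.ne']
    simpa using (tendsto_log_add_one_div hN h1).const_mul (#D.Λ.support : ℝ)
  refine absurd (DegreeDist.le_of_forall_le hV hC hcap hS hσ hσcap (x := x) fun v hv => ?_)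
    (not_le.2 hx)
  have hcheck : Tendsto (fun i => ∑ j, (∑ r ∈ (D.Γ j).support,
      ((E i).checkCount j r : ℝ) / (E i).blockLength * log (q r (v j)) -
      (typeWeight D (k i) j : ℝ) / (E i).blockLength * log (v j))) F
      (𝓝 (∑ j, D.checkPart j (D.edgeFrac σ j) (v j))) := by
    refine tendsto_finsetSum _ fun j _ => ?_
    have h1 : D.checkPart j (D.edgeFrac σ j) (v j) = ∑ r ∈ (D.Γ j).support,
        D.avgVar j / D.avgCheck j * D.Γ j r * log (q r (v j)) -
        D.avgVar j * D.edgeFrac σ j * log (v j) := by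
      rw [DegreeDist.checkPart, mul_sum]
      congr 1
      exact sum_congr rfl fun r _ => by ring
    rw [h1]
    exact (tendsto_finsetSum _ fun r _ => (hmlim j r).mul_const _).sub ((hWlim j).mul_const _)
  have hlim := (hpoly.add (h.tendsto_log_chooses hV hF hk hkσ)).add hcheck
  rw [zero_add, sub_add_eq_add_sub] at hlim
  refine ge_of_tendsto hlim ?_
  filter_upwards [hbad] with i hi
  refine hi.trans ?_
  have hB : (0 : ℝ) < (E i).blockLength + 1 := by positivity
  have h1 : log (E i).expectedCodewords ≤
      (#D.Λ.support : ℝ) * log ((E i).blockLength + 1) + log ((E i).typeTerm (k i)) := by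
    rw [← log_pow, ← log_mul (pow_pos hB _).ne' (htpos i).ne']
    refine log_le_log (E i).expectedCodewords_pos ((hkle i).trans ?_)
    refine mul_le_mul_of_nonneg_right ?_ (htpos i).le
    refine pow_le_pow_right₀ (by linarith [Nat.cast_nonneg (α := ℝ) (E i).blockLength]) ?_
    refine card_le_card fun l hl => ?_
    rw [Finsupp.mem_support_iff] at hl ⊢
    exact fun h0 => hl (h.varCount_eq_zero i l h0)
  have h2 := div_le_div_of_nonneg_right h1 (Nat.cast_nonneg (α := ℝ) (E i).blockLength)
  rw [add_div, mul_div_assoc, h.log_typeTerm i (hk i) (hcoeff i), ← add_assoc] at h2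
  refine h2.trans ?_
  gcongr with j
  -- The bound is used at a fixed, arbitrary `v`. The choice of the best `v` is left to
  -- `le_of_forall_le`.
  have h3 := (E i).coeff_checkPoly_mul_pow_le j (typeWeight D (k i) j) (hv j)
  rw [h.prod_checkCount i j (fun r => q r (v j) ^ (E i).checkCount j r) fun r hr => by
    rw [hr, pow_zero]] at h3
  have hc : (0 : ℝ) < ((E i).checkPoly j).coeff (typeWeight D (k i) j) := by
    exact_mod_cast hcoeff i j
  have h4 := log_le_log (mul_pos hc (pow_pos (hv j) _)) h3
  rw [log_mul hc.ne' (pow_pos (hv j) _).ne', log_pow, log_prod fun r _ =>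
    (pow_pos (q_pos r (hv j)) _).ne'] at h4
  simp only [log_pow] at h4
  rw [div_mul_eq_mul_div]
  simp only [div_mul_eq_mul_div]
  rw [← sum_div, ← sub_div]
  exact div_le_div_of_nonneg_right (by linarith) (Nat.cast_nonneg _)

end Types

end HasDegreeDist

end TwoEdgeLDPC

end

theorem mainTheorem2 (D : TwoEdgeLDPC.DegreeDist)
    (hvar : ∀ j, ∃ l, l j ≠ 0 ∧ 0 < D.Λ l)
    (hcheck : ∀ j, ∃ r, 2 ≤ r ∧ 0 < D.Γ j r) :
    (∀ e t t', D.IsTheta e t → D.IsTheta e t' → t = t') ∧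
    ∃ S : ℝ, IsLUB {t | ∃ e ∈ D.region, D.IsTheta e t} S ∧
      ∀ E : ℕ → TwoEdgeLDPC.Ensemble, TwoEdgeLDPC.HasDegreeDist E D →
        Filter.Tendsto
          (fun k => Real.logb 2 (E k).expectedCodewords / ((E k).blockLength : ℝ))
          Filter.atTop (nhds (S + D.designRate)) := by
  have hV : ∀ j, 0 < D.avgVar j := fun j => TwoEdgeLDPC.DegreeDist.avgVar_pos (hvar j)
  have hC : ∀ j, 0 < D.avgCheck j := fun j => TwoEdgeLDPC.DegreeDist.avgCheck_pos (hcheck j)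
  have hcap : ∀ j, 0 < D.checkCap j := fun j => TwoEdgeLDPC.DegreeDist.checkCap_pos (hcheck j)
  refine ⟨fun e t t' ht ht' => ht.unique hV hC ht', ?_⟩
  obtain ⟨S, hS⟩ := Real.exists_isLUB (TwoEdgeLDPC.DegreeDist.isTheta_nonempty hV hC hcap)
    (TwoEdgeLDPC.DegreeDist.isTheta_bddAbove hV hC)
  refine ⟨S, hS, fun E hE => ?_⟩
  have h2 : 0 < Real.log 2 := Real.log_pos one_lt_two
  have hlog : ∀ k, Real.logb 2 (E k).expectedCodewords / ((E k).blockLength : ℝ) =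
      Real.log (E k).expectedCodewords / ((E k).blockLength : ℝ) / Real.log 2 := fun k => by
    rw [Real.logb, div_right_comm]
  simp only [hlog]
  refine tendsto_order.2 ⟨fun x hx => ?_, fun x hx => ?_⟩
  -- The supremum need not be attained: a saddle point whose value exceeds `x - D.designRate`
  -- suffices.
  · obtain ⟨t, ⟨e, -, u, v, hs, rfl⟩, hlt⟩ := (lt_isLUB_iff hS).1 (sub_lt_iff_lt_add.2 hx)
    obtain ⟨f, hf, hfle⟩ := hE.exists_le_log_expectedCodewords hV hC hcheck hs
    have h3 : x * Real.log 2 < (D.thetaExpr e u v + D.designRate) * Real.log 2 :=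
      mul_lt_mul_of_pos_right (by linarith) h2
    filter_upwards [hfle, hf.eventually_const_lt h3] with k hk1 hk2
    rw [lt_div_iff₀ h2]
    linarith
  · filter_upwards [hE.eventually_log_expectedCodewords_lt hV hC hcap hS.1
      (mul_lt_mul_of_pos_right hx h2)] with k hk
    rwa [div_lt_iff₀ h2]
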